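/- Let $F$ be a closed surface (compact, Hausdorff, locally homeomorphic to $\mathbb R^2$, without boundary; orientability is not needed). A resolution configuration $D=(Z(D),A(D))$ on $F$ consists of a finite set $Z(D)$ of pairwise disjoint embedded circles and a finite ordered collection $A(D)$ of pairwise disjoint embedded arcs in $F$ with $A(D)\cap Z(D)=\partial A(D)$. The arcs come with pairwise disjoint embedded bands around them that meet the circles exactly in their ends. For $A\subseteq A(D)$ let $s_A(D)$ be the resolution configuration obtained by embedded surgery along the arcs (with their bands) in $A$, with $A(s_A(D))=A(D)\setminus A$, and let $s(D)=s_{A(D)}(D)$. A labeling of a configuration assigns $x_+$ or $x_-$ to each of its circles; put $\deg x_\pm=\pm1$. A labeled configuration $(D,x)$ has the quantum grading $\mathrm{gr}_q(D,x)=-|A(D)|+\sum_{Z\in Z(D)}\deg x(Z)$ (up to an additive constant common to all the configurations $s_A(D)$) and the homotopical grading $\mathrm{gr}_{\mathfrak H}(D,x)=\sum_{Z\in Z(D)}\deg x(Z)\,[Z]\in\mathfrak H$, where $\mathfrak H$ is the free abelian group on the free homotopy classes of loops in $F$ modulo the relations $[\gamma]=0$ for contractible $\gamma$ and $[\gamma]=[-\gamma]$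 for all $\gamma$. Let $\prec$ be the reflexive and transitive closure of the following relation: $(E,y)$ is related to $(D,x)$ if $D=s_{\{a\}}(E)$ for a single arc $a\in A(E)$, $x$ and $y$ agree on the circles common to $D$ and $E$, and $\mathrm{gr}_q(E,y)=\mathrm{gr}_q(D,x)$, $\mathrm{gr}_{\mathfrak H}(E,y)=\mathrm{gr}_{\mathfrak H}(D,x)$. A decorated resolution configuration $\mathcal D=(D,x,y)$ is a resolution configuration $D$ with a labeling $x$ of $s(D)$ and a labeling $y$ of $D$. Its multiplicity is $$\mu(\mathcal D)=\max_{A\subseteq A(D)}\#\{z \text{ a labeling of } s_A(D)\;:\;(D,y)\prec(s_A(D),z)\prec(s(D),x)\}.$$ The connected components of $\mathcal D$ are $\mathcal D_i=(D_i,x|_{s(D_i)},y|_{D_i})$, $i=1,\dots,l$, where $D_1,\dots,D_l$ consist of the circles and arcs of $D$ that lie in the respective connected components of the union of all circles and arcs of $D$. **Proposition.** For every decorated resolution configuration $\mathcal D$ on $F$ with connected components $\mathcal D_1,\dots,\mathcal D_l$, $$\mu(\mathcal D)=\mu(\mathcal D_1)\cdots\mu(\mathcal D_l),$$ where the empty product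 (for the empty configuration, $l=0$) is $1$. -/

import Mathlib

open Set Topology unitInterval
namespace Resolution
variable {F : Type*} [TopologicalSpace F]

/-- The subset `C` of `F` is an embedded circle. -/
def IsEmbeddedCircle (C : Set F) : Prop :=
  ∃ γ : C(Circle, F), IsEmbedding γ ∧ range γ = C

/-- The subset `S` of `F` is the image of an injective path from `p` to `q`. -/
def IsArc (S : Set F) (p q : F) : Prop :=
  ∃ γ : Path p q, Function.Injective γ ∧ range γ = S

theorem IsArc.symm {S : Set F} {p q : F} (h : IsArc S p q) : IsArc S q p := by
  obtain ⟨γ, h1, h2⟩ := h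
  refine ⟨γ.symm, ?_, by rw [Path.symm_range, h2]⟩
  intro x y hxy
  have : σ x = σ y := h1 hxy
  simpa using congrArg σ this

theorem IsArc.left_mem {S : Set F} {p q : F} (h : IsArc S p q) : p ∈ S := by
  obtain ⟨γ, _, h2⟩ := h
  exact h2 ▸ γ.source_mem_range

theorem IsArc.right_mem {S : Set F} {p q : F} (h : IsArc S p q) : q ∈ S := h.symm.left_mem

theorem IsArc.trans {S T : Set F} {p q r : F} (h : IsArc S p q) (h' : IsArc T q r)
    (hST : S ∩ T ⊆ {q}) : IsArc (S ∪ T) p r := by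
  obtain ⟨α, hα, rfl⟩ := h
  obtain ⟨β, hβ, rfl⟩ := h'
  refine ⟨α.trans β, ?_, Path.trans_range _ _⟩
  have key : ∀ s t : I, α s = β t → s = 1 ∧ t = 0 := by
    intro s t hst
    have : α s = q := hST ⟨mem_range_self s, hst ▸ mem_range_self t⟩
    exact ⟨hα (by rw [this, α.target]), hβ (by rw [← hst, this, β.source])⟩
  intro x y hxy
  rw [Path.trans_apply, Path.trans_apply] at hxy
  split_ifs at hxy with h1 h2 h2
  · have := congrArg Subtype.val (hα hxy)
    exact Subtype.ext (by simpa using this)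
  · obtain ⟨_, h4⟩ := key _ _ hxy
    have := congrArg Subtype.val h4
    simp only [Icc.coe_zero] at this
    push Not at h2
    linarith
  · obtain ⟨_, h4⟩ := key _ _ hxy.symm
    have := congrArg Subtype.val h4
    simp only [Icc.coe_zero] at this
    push Not at h1
    linarith
  · have := congrArg Subtype.val (hβ hxy)
    simp only at this
    exact Subtype.ext (by linarith)

theorem isEmbeddedCircle_of_arcs [T2Space F] {S T : Set F} {p q : F} (h : IsArc S p q)
    (h' : IsArc T q p) (hST : S ∩ T ⊆ {p, q}) : IsEmbeddedCircle (S ∪ T) := by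
  obtain ⟨α, hα, rfl⟩ := h
  obtain ⟨β, hβ, rfl⟩ := h'
  have hpq : p ≠ q := fun h => zero_ne_one (hα (by rw [α.source, α.target, h] : α 0 = α 1))
  have key : ∀ s t : I, α s = β t → (s = 0 ∧ t = 1) ∨ (s = 1 ∧ t = 0) := by
    intro s t hst
    have : α s = p ∨ α s = q := hST ⟨mem_range_self s, hst ▸ mem_range_self t⟩
    rcases this with h | h
    · exact Or.inl ⟨hα (by rw [h, α.source]), hβ (by rw [← hst, h, β.target])⟩
    · exact Or.inr ⟨hα (by rw [h, α.target]), hβ (by rw [← hst, h, β.source])⟩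
  set γ : Path p p := α.trans β with hγ
  have hinj : ∀ x y : I, (x : ℝ) < 1 → (y : ℝ) < 1 → γ x = γ y → x = y := by
    intro x y hx hy hxy
    rw [hγ, Path.trans_apply, Path.trans_apply] at hxy
    split_ifs at hxy with h1 h2 h2
    · have := congrArg Subtype.val (hα hxy)
      exact Subtype.ext (by simpa using this)
    · rcases key _ _ hxy with ⟨_, h4⟩ | ⟨_, h4⟩ <;>
      · have := congrArg Subtype.val h4
        simp only [Icc.coe_zero, Icc.coe_one] at this
        push Not at h2
        linarith
    · rcases key _ _ hxy.symm with ⟨_, h4⟩ | ⟨_, h4⟩ <;>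
      · have := congrArg Subtype.val h4
        simp only [Icc.coe_zero, Icc.coe_one] at this
        push Not at h1
        linarith
    · have := congrArg Subtype.val (hβ hxy)
      simp only at this
      exact Subtype.ext (by linarith)
  have : Fact ((0 : ℝ) < 1) := ⟨one_pos⟩
  let f : UnitAddCircle → F := AddCircle.liftIco 1 0 γ.extend
  have hf : Continuous f :=
    AddCircle.liftIco_zero_continuous (by simp) γ.continuous_extend.continuousOn
  have hval : ∀ (x : ℝ) (hx : x ∈ Ico (0 : ℝ) 1),
      f (x : UnitAddCircle) = γ ⟨x, hx.1, hx.2.le⟩ := by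
    intro x hx
    rw [show f (x : UnitAddCircle) = γ.extend x from AddCircle.liftIco_zero_coe_apply hx]
    exact γ.extend_apply ⟨hx.1, hx.2.le⟩
  have hrep : ∀ z : UnitAddCircle, ∃ x ∈ Ico (0 : ℝ) 1, (x : UnitAddCircle) = z := by
    intro z
    have := AddCircle.coe_image_Ico_eq (1 : ℝ) 0
    have hz : z ∈ ((↑) : ℝ → UnitAddCircle) '' Ico 0 (0 + 1) := by rw [this]; trivial
    simpa using hz
  have hfi : Function.Injective f := by
    intro z w hzw
    obtain ⟨x, hx, rfl⟩ := hrep z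
    obtain ⟨y, hy, rfl⟩ := hrep w
    rw [hval x hx, hval y hy] at hzw
    have := congrArg Subtype.val (hinj _ _ hx.2 hy.2 hzw)
    simp only at this
    rw [this]
  have hfr : range f = range α ∪ range β := by
    rw [← Path.trans_range, ← hγ]
    apply Subset.antisymm
    · rintro _ ⟨z, rfl⟩
      obtain ⟨x, hx, rfl⟩ := hrep z
      rw [hval x hx]
      exact mem_range_self _
    · rintro _ ⟨x, rfl⟩
      rcases eq_or_lt_of_le x.2.2 with h | h
      · refine ⟨((0 : ℝ) : UnitAddCircle), ?_⟩
        rw [hval 0 ⟨le_rfl, one_pos⟩]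
        have : x = 1 := Subtype.ext h
        rw [this, γ.target]
        exact γ.source
      · exact ⟨((x : ℝ) : UnitAddCircle), hval x ⟨x.2.1, h⟩⟩
  let e : Circle ≃ₜ UnitAddCircle := (AddCircle.homeomorphCircle one_ne_zero).symm
  refine ⟨⟨f ∘ e, hf.comp e.continuous⟩, ?_, ?_⟩
  · exact ((hf.comp e.continuous).isClosedEmbedding (hfi.comp e.injective)).isEmbedding
  · rw [ContinuousMap.coe_mk, e.surjective.range_comp, hfr]

theorem IsArc.subpath {p q : F} {γ : Path p q} (hγ : Function.Injective γ) {s t : I}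
    (hst : s < t) : IsArc (γ '' Icc s t) (γ s) (γ t) := by
  refine ⟨γ.subpath s t, ?_, γ.range_subpath_of_le s t hst.le⟩
  have h0 : (0 : ℝ) < t - s := sub_pos.2 hst
  intro x y hxy
  have := congrArg Subtype.val (hγ hxy)
  simp [Set.Icc.convexComb] at this
  have h2 : ((t : ℝ) - s) * (x - y) = 0 := by linear_combination this
  rcases mul_eq_zero.1 h2 with h | h
  · linarith
  · exact Subtype.ext (by linarith)

/-- Two distinct points of an embedded circle cut it into two arcs. -/
theorem IsEmbeddedCircle.split {C : Set F} (hC : IsEmbeddedCircle C) {p q : F} (hp : p ∈ C)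
    (hq : q ∈ C) (hpq : p ≠ q) :
    ∃ S T, IsArc S p q ∧ IsArc T p q ∧ S ∪ T = C ∧ S ∩ T ⊆ {p, q} := by
  have : Fact ((0 : ℝ) < 1) := ⟨one_pos⟩
  obtain ⟨g, hg, rfl⟩ := hC
  obtain ⟨p, rfl⟩ := hp
  obtain ⟨q, rfl⟩ := hq
  let e : UnitAddCircle ≃ₜ Circle := AddCircle.homeomorphCircle one_ne_zero
  let f : UnitAddCircle → F := fun z => g (e (z + e.symm p))
  have hf : Continuous f := by fun_prop
  have hfi : Function.Injective f := fun x y h => add_right_cancel (e.injective (hg.injective h))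
  have hfs : range f = range g := by
    apply Subset.antisymm
    · rintro _ ⟨z, rfl⟩; exact mem_range_self _
    · rintro _ ⟨z, rfl⟩; exact ⟨e.symm z - e.symm p, by simp [f]⟩
  have hrep : ∀ z : UnitAddCircle, ∃ x ∈ Ico (0 : ℝ) 1, (x : UnitAddCircle) = z := by
    intro z
    have := AddCircle.coe_image_Ico_eq (1 : ℝ) 0
    have hz : z ∈ ((↑) : ℝ → UnitAddCircle) '' Ico 0 (0 + 1) := by rw [this]; trivial
    simpa using hz
  have hinj : ∀ x ∈ Ico (0 : ℝ) 1, ∀ y ∈ Ico (0 : ℝ) 1, f (x : UnitAddCircle) = f y → x = y := by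
    intro x hx y hy h
    exact (AddCircle.coe_eq_coe_iff_of_mem_Ico (p := (1 : ℝ)) (a := 0) (by simpa using hx)
      (by simpa using hy)).1 (hfi h)
  have h0 : f ((0 : ℝ) : UnitAddCircle) = g p := by simp [f]
  have h1 : f ((1 : ℝ) : UnitAddCircle) = g p := by
    rw [← h0]; congr 1; simp
  obtain ⟨t, ht, htq⟩ := hrep (e.symm q - e.symm p)
  have htq' : f (t : UnitAddCircle) = g q := by rw [htq]; simp [f]
  have ht0 : 0 < t := by
    rcases eq_or_lt_of_le ht.1 with h | h
    · exact absurd (by rw [← h0, ← htq', ← h]) hpq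
    · exact h
  have hc : Continuous fun x : ℝ => f (x : UnitAddCircle) :=
    hf.comp (AddCircle.continuous_mk' 1)
  let α : Path (g p) (g q) :=
    { toFun := fun x => f ((t * x : ℝ) : UnitAddCircle)
      continuous_toFun := hc.comp (by fun_prop)
      source' := by simpa using h0
      target' := by simpa using htq' }
  let β : Path (g p) (g q) :=
    { toFun := fun x => f ((1 - (1 - t) * x : ℝ) : UnitAddCircle)
      continuous_toFun := hc.comp (by fun_prop)
      source' := by simpa using h1
      target' := by simpa using htq' }
  have hα : ∀ x : I, α x = f ((t * x : ℝ) : UnitAddCircle) := fun _ => rfl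
  have hβ : ∀ x : I, β x = f ((1 - (1 - t) * x : ℝ) : UnitAddCircle) := fun _ => rfl
  have ht1 : 0 < 1 - t := sub_pos.2 ht.2
  have hαm : ∀ x : I, t * (x : ℝ) ∈ Ico (0 : ℝ) 1 := fun x =>
    ⟨mul_nonneg ht.1 x.2.1, by nlinarith [x.2.2, x.2.1]⟩
  have hβm : ∀ x : I, x ≠ 0 → 1 - (1 - t) * (x : ℝ) ∈ Ico (0 : ℝ) 1 := fun x hx => by
    have hx0 : (0 : ℝ) < x := lt_of_le_of_ne x.2.1 (fun h => hx (Subtype.ext h.symm))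
    exact ⟨by nlinarith [x.2.2, x.2.1], by nlinarith⟩
  have hβ0 : β 0 = g p := β.source
  have hβne : ∀ x : I, x ≠ 0 → β x ≠ g p := by
    intro x hx h
    rw [hβ, ← h0] at h
    have := hinj _ (hβm x hx) 0 ⟨le_rfl, one_pos⟩ h
    nlinarith [x.2.2, x.2.1]
  refine ⟨range α, range β, ⟨α, ?_, rfl⟩, ⟨β, ?_, rfl⟩, ?_, ?_⟩
  · intro x y h
    rw [hα, hα] at h
    have := hinj _ (hαm x) _ (hαm y) h
    exact Subtype.ext (mul_left_cancel₀ ht0.ne' this)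
  · intro x y h
    by_cases hx : x = 0
    · by_cases hy : y = 0
      · rw [hx, hy]
      · exact absurd (by rw [← h, hx, hβ0]) (hβne y hy)
    · by_cases hy : y = 0
      · exact absurd (by rw [h, hy, hβ0]) (hβne x hx)
      · rw [hβ, hβ] at h
        have := hinj _ (hβm x hx) _ (hβm y hy) h
        exact Subtype.ext (mul_left_cancel₀ ht1.ne' (by linarith))
  · rw [← hfs]
    apply Subset.antisymm
    · rintro _ (⟨x, rfl⟩ | ⟨x, rfl⟩)
      · exact mem_range_self _
      · exact mem_range_self _
    · rintro _ ⟨z, rfl⟩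
      obtain ⟨x, hx, rfl⟩ := hrep z
      rcases le_total x t with h | h
      · left
        refine ⟨⟨x / t, div_nonneg hx.1 ht.1, (div_le_one ht0).2 h⟩, ?_⟩
        rw [hα]
        simp only
        rw [mul_div_cancel₀ _ ht0.ne']
      · right
        refine ⟨⟨(1 - x) / (1 - t), div_nonneg (by linarith [hx.2]) ht1.le,
          (div_le_one ht1).2 (by linarith)⟩, ?_⟩
        rw [hβ]
        simp only
        rw [mul_div_cancel₀ _ ht1.ne', sub_sub_cancel]
  · rintro _ ⟨⟨x, rfl⟩, ⟨y, hy⟩⟩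
    by_cases hy0 : y = 0
    · left; rw [← hy, hy0, hβ0]
    · right
      rw [hβ, hα] at hy
      have := hinj _ (hβm y hy0) _ (hαm x) hy
      have h2 : (x : ℝ) = 1 := by
        have := x.2.2; have := y.2.2
        have h3 : (1 - t) * (1 - (y : ℝ)) ≥ 0 := mul_nonneg ht1.le (by linarith)
        have h4 : t * (1 - (x : ℝ)) ≥ 0 := mul_nonneg ht0.le (by linarith)
        have h5 : t * (1 - (x : ℝ)) = 0 := by linarith
        rcases mul_eq_zero.1 h5 with h | h <;> linarith
      have : x = 1 := Subtype.ext h2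
      rw [this]; exact α.target

/-- A subarc of an arc is the image of the parameter interval between its end points. -/
theorem range_eq_image_uIcc [T2Space F] {p q r s : F} {γ : Path p q} (hγ : Function.Injective γ)
    {τ : Path r s} (hτ : Function.Injective τ) (h : range τ ⊆ range γ) :
    ∃ t u : I, γ t = r ∧ γ u = s ∧ range τ = γ '' uIcc t u := by
  have hemb : IsEmbedding γ := (γ.continuous.isClosedEmbedding hγ).isEmbedding
  choose g hg using fun x : I => h (mem_range_self x)
  have hgc : Continuous g := by
    rw [hemb.continuous_iff]
    have : γ ∘ g = τ := funext hg
    rw [this]; exact τ.continuous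
  have hgi : Function.Injective g := fun x y hxy => hτ (by rw [← hg, ← hg, hxy])
  refine ⟨g 0, g 1, by rw [hg, τ.source], by rw [hg, τ.target], ?_⟩
  have hr : range τ = γ '' range g := by
    rw [← range_comp]; congr 1; exact (funext hg).symm
  rw [hr]
  congr 1
  apply Subset.antisymm
  · rintro _ ⟨x, rfl⟩
    rcases hgc.strictMono_of_inj_boundedOrder' hgi with hm | hm
    · exact Icc_subset_uIcc ⟨hm.monotone x.2.1, hm.monotone x.2.2⟩
    · exact Icc_subset_uIcc' ⟨hm.antitone x.2.2, hm.antitone x.2.1⟩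
  · exact (isPreconnected_range hgc).ordConnected.uIcc_subset (mem_range_self 0) (mem_range_self 1)

theorem IsArc.isClosed [T2Space F] {S : Set F} {p q : F} (h : IsArc S p q) : IsClosed S := by
  obtain ⟨γ, _, rfl⟩ := h
  exact (isCompact_range γ.continuous).isClosed

/-- The complement of an open arc in an embedded circle is an arc. -/
theorem IsEmbeddedCircle.compl_arc [T2Space F] {C T : Set F} (hC : IsEmbeddedCircle C) {p q : F}
    (hT : IsArc T p q) (hTC : T ⊆ C) :
    ∃ S, IsArc S q p ∧ S ∪ T = C ∧ S ∩ T ⊆ {p, q} := by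
  have hTa := hT
  obtain ⟨τ, hτ, rfl⟩ := hT
  have hpq : p ≠ q := fun h => zero_ne_one (hτ (by rw [τ.source, τ.target, h] : τ 0 = τ 1))
  obtain ⟨S₁, S₂, h₁, h₂, hU, hI⟩ := hC.split (hTC hTa.left_mem) (hTC hTa.right_mem) hpq
  have hmid : IsPreconnected (τ '' Ioo 0 1) :=
    isPreconnected_Ioo.image _ τ.continuous.continuousOn
  have hcover : range τ = τ '' Ioo 0 1 ∪ {p, q} := by
    apply Subset.antisymm
    · rintro _ ⟨x, rfl⟩
      rcases eq_or_lt_of_le x.2.1 with h | h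
      · right; left
        have : x = 0 := Subtype.ext h.symm
        rw [this, τ.source]
      · rcases eq_or_lt_of_le x.2.2 with h' | h'
        · right; right
          have : x = 1 := Subtype.ext h'
          rw [this, τ.target]; rfl
        · left; exact mem_image_of_mem _ ⟨h, h'⟩
    · rintro x (⟨y, _, rfl⟩ | rfl | rfl)
      · exact mem_range_self _
      · exact τ.source_mem_range
      · exact τ.target_mem_range
  have hnot : ∀ x ∈ τ '' Ioo 0 1, x ∉ ({p, q} : Set F) := by
    rintro _ ⟨x, hx, rfl⟩ (h | h)
    · exact hx.1.ne' (hτ (by rw [h, τ.source]))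
    · exact hx.2.ne (hτ (by rw [h, τ.target]))
  have hsub : ∀ S, IsArc S p q → τ '' Ioo 0 1 ⊆ S → range τ = S := by
    intro S hS hs
    have hr : range τ ⊆ S := by
      rw [hcover]
      rintro x (hx | rfl | rfl)
      exacts [hs hx, hS.left_mem, hS.right_mem]
    obtain ⟨γ, hγ, rfl⟩ := hS
    obtain ⟨t, u, ht, hu, he⟩ := range_eq_image_uIcc hγ hτ hr
    have ht' : t = 0 := hγ (by rw [ht, γ.source])
    have hu' : u = 1 := hγ (by rw [hu, γ.target])
    rw [he, ht', hu', uIcc_of_le zero_le_one]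
    have : Icc (0 : I) 1 = univ := eq_univ_of_forall fun x => ⟨x.2.1, x.2.2⟩
    rw [this, image_univ]
  have hor : τ '' Ioo 0 1 ⊆ S₁ ∨ τ '' Ioo 0 1 ⊆ S₂ := by
    by_contra hcon
    push Not at hcon
    obtain ⟨⟨x, hx, hx1⟩, ⟨y, hy, hy2⟩⟩ := And.intro (not_subset.1 hcon.1) (not_subset.1 hcon.2)
    have hsubU : τ '' Ioo 0 1 ⊆ S₁ ∪ S₂ := by
      rw [hU]; exact (image_subset_range _ _).trans hTC
    obtain ⟨z, hz, hz'⟩ := isPreconnected_closed_iff.1 hmid S₁ S₂ h₁.isClosed h₂.isClosed hsubU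
      ⟨y, hy, (hsubU hy).resolve_right hy2⟩ ⟨x, hx, (hsubU hx).resolve_left hx1⟩
    exact hnot z hz (hI hz')
  rcases hor with h | h
  · rw [hsub _ h₁ h]
    exact ⟨S₂, h₂.symm, by rw [union_comm, hU], by rw [inter_comm]; exact hI⟩
  · rw [hsub _ h₂ h]
    exact ⟨S₁, h₁.symm, hU, hI⟩

/-- Removing an open subarc from an arc leaves two arcs. -/
theorem IsArc.compl_arc [T2Space F] {S T : Set F} {p q r s : F} (hS : IsArc S p q)
    (hT : IsArc T r s) (hTS : T ⊆ S) (hp : p ∉ T) (hq : q ∉ T) :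
    ∃ S₁ S₂, ((IsArc S₁ p r ∧ IsArc S₂ s q) ∨ (IsArc S₁ p s ∧ IsArc S₂ r q)) ∧
      S₁ ∪ T ∪ S₂ = S ∧ S₁ ∩ T ⊆ {r, s} ∧ S₂ ∩ T ⊆ {r, s} ∧ S₁ ∩ S₂ = ∅ := by
  wlog hle : ∃ γ : Path p q, Function.Injective γ ∧ range γ = S ∧
      ∃ t u : I, γ t = r ∧ γ u = s ∧ t < u ∧ T = γ '' Icc t u generalizing r s
  · obtain ⟨γ, hγ, rfl⟩ := hS
    have hT' := hT
    obtain ⟨τ, hτ, rfl⟩ := hT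
    obtain ⟨t, u, ht, hu, he⟩ := range_eq_image_uIcc hγ hτ hTS
    have htu : t ≠ u := by
      rintro rfl
      exact zero_ne_one (hτ (by rw [τ.source, τ.target, ← ht, ← hu] : τ 0 = τ 1))
    rcases lt_or_gt_of_ne htu with h | h
    · exact absurd ⟨γ, hγ, rfl, t, u, ht, hu, h, by rw [he, uIcc_of_le h.le]⟩ hle
    · obtain ⟨S₁, S₂, h1, h2, h3, h4, h5⟩ := this hT'.symm
        ⟨γ, hγ, rfl, u, t, hu, ht, h, by rw [he, uIcc_of_ge h.le]⟩
      exact ⟨S₁, S₂, h1.symm, h2, by rwa [pair_comm], by rwa [pair_comm], h5⟩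
  · obtain ⟨γ, hγ, rfl, t, u, rfl, rfl, htu, rfl⟩ := hle
    have h0 : 0 < t := by
      rcases eq_or_lt_of_le t.2.1 with h | h
      · refine absurd ⟨0, ⟨?_, u.2.1⟩, γ.source⟩ hp
        exact (Subtype.ext h.symm : t = 0).le
      · exact h
    have h1 : u < 1 := by
      rcases eq_or_lt_of_le u.2.2 with h | h
      · refine absurd ⟨1, ⟨t.2.2, ?_⟩, γ.target⟩ hq
        exact (Subtype.ext h : u = 1).ge
      · exact h
    refine ⟨γ '' Icc 0 t, γ '' Icc u 1, Or.inl ⟨?_, ?_⟩, ?_, ?_, ?_, ?_⟩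
    · simpa using IsArc.subpath hγ h0
    · simpa using IsArc.subpath hγ h1
    · rw [← image_union, ← image_union, Icc_union_Icc_eq_Icc h0.le htu.le,
        Icc_union_Icc_eq_Icc (h0.trans htu).le h1.le]
      have : Icc (0 : I) 1 = univ := eq_univ_of_forall fun x => ⟨x.2.1, x.2.2⟩
      rw [this, image_univ]
    · rw [← image_inter hγ]
      rintro _ ⟨x, ⟨hx, hx'⟩, rfl⟩
      left; rw [le_antisymm hx.2 hx'.1]
    · rw [← image_inter hγ]
      rintro _ ⟨x, ⟨hx, hx'⟩, rfl⟩
      right; rw [mem_singleton_iff, le_antisymm hx'.2 hx.1]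
    · rw [← image_inter hγ, image_eq_empty, ← disjoint_iff_inter_eq_empty,
        Set.disjoint_left]
      intro x hx hx'
      exact absurd (hx'.1.trans hx.2) (not_le.2 htu)

theorem IsEmbeddedCircle.isCompact {C : Set F} (h : IsEmbeddedCircle C) : IsCompact C := by
  obtain ⟨γ, _, rfl⟩ := h
  exact isCompact_range γ.continuous

theorem IsEmbeddedCircle.isConnected {C : Set F} (h : IsEmbeddedCircle C) : IsConnected C := by
  obtain ⟨γ, _, rfl⟩ := h
  have : ConnectedSpace Circle := by
    have h := AddCircle.homeomorphCircle (T := 1) one_ne_zero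
    exact h.surjective.connectedSpace h.continuous
  exact isConnected_range γ.continuous

theorem IsArc.isPreconnected {S : Set F} {p q : F} (h : IsArc S p q) : IsPreconnected S := by
  obtain ⟨γ, _, rfl⟩ := h
  exact isPreconnected_range γ.continuous

/-- A multicircle: a union of finitely many pairwise disjoint embedded circles. -/
def IsMulticircle (Z : Set F) : Prop :=
  ∃ 𝒞 : Set (Set F), 𝒞.Finite ∧ (∀ C ∈ 𝒞, IsEmbeddedCircle C) ∧ 𝒞.PairwiseDisjoint id ∧ ⋃₀ 𝒞 = Z

theorem IsMulticircle.union {Z W : Set F} (hZ : IsMulticircle Z) (hW : IsMulticircle W)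
    (h : Disjoint Z W) : IsMulticircle (Z ∪ W) := by
  obtain ⟨𝒞, h1, h2, h3, rfl⟩ := hZ
  obtain ⟨𝒟, h1', h2', h3', rfl⟩ := hW
  refine ⟨𝒞 ∪ 𝒟, h1.union h1', ?_, ?_, sUnion_union _ _⟩
  · rintro C (hC | hC)
    exacts [h2 C hC, h2' C hC]
  · rw [pairwiseDisjoint_union]
    refine ⟨h3, h3', fun C hC D hD _ => ?_⟩
    exact h.mono (subset_sUnion_of_mem hC) (subset_sUnion_of_mem hD)

theorem IsEmbeddedCircle.isMulticircle {C : Set F} (h : IsEmbeddedCircle C) : IsMulticircle C :=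
  ⟨{C}, finite_singleton C, by simpa using h, pairwiseDisjoint_singleton _ _, sUnion_singleton C⟩

theorem IsMulticircle.isClosed [T2Space F] {Z : Set F} (hZ : IsMulticircle Z) : IsClosed Z := by
  obtain ⟨𝒞, h1, h2, h3, rfl⟩ := hZ
  rw [sUnion_eq_biUnion]
  exact h1.isClosed_biUnion fun C hC => (h2 C hC).isCompact.isClosed

/-- A connected set covered by two disjoint closed sets and meeting the first lies in it. -/
theorem subset_of_closed_split {T X W : Set F} (hT : IsPreconnected T) (hX : IsClosed X)
    (hW : IsClosed W) (hXW : X ∩ W = ∅) (h : T ⊆ X ∪ W) (hne : (T ∩ X).Nonempty) : T ⊆ X := by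
  intro x hx
  by_contra hxX
  obtain ⟨z, _, hz⟩ := isPreconnected_closed_iff.1 hT X W hX hW h hne
    ⟨x, hx, (h hx).resolve_left hxX⟩
  rw [hXW] at hz
  exact hz

/-- Splitting off the circle of a multicircle that contains a given connected subset. -/
theorem IsMulticircle.split_off [T2Space F] {Z T : Set F} (hZ : IsMulticircle Z)
    (hT : IsPreconnected T) (hTZ : T ⊆ Z) (hne : T.Nonempty) :
    ∃ C R, IsEmbeddedCircle C ∧ IsMulticircle R ∧ C ∩ R = ∅ ∧ C ∪ R = Z ∧ T ⊆ C := by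
  obtain ⟨𝒞, h1, h2, h3, rfl⟩ := hZ
  obtain ⟨p, hp⟩ := hne
  obtain ⟨C, hC, hpC⟩ := hTZ hp
  have hR : IsMulticircle (⋃₀ (𝒞 \ {C})) :=
    ⟨𝒞 \ {C}, h1.sdiff, fun D hD => h2 D hD.1, h3.subset sdiff_subset, rfl⟩
  have hd : C ∩ ⋃₀ (𝒞 \ {C}) = ∅ := by
    rw [← disjoint_iff_inter_eq_empty, disjoint_sUnion_right]
    exact fun D hD => h3 hC hD.1 (fun h => hD.2 h.symm)
  have hU : C ∪ ⋃₀ (𝒞 \ {C}) = ⋃₀ 𝒞 := by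
    rw [← sUnion_insert, insert_sdiff_singleton, insert_eq_of_mem hC]
  exact ⟨C, _, h2 C hC, hR, hd, hU, subset_of_closed_split hT (h2 C hC).isCompact.isClosed
    hR.isClosed hd (by rwa [hU]) ⟨p, hp, hpC⟩⟩

/-- Replacing two disjoint subarcs of a multicircle by two arcs that join their end points
crosswise gives a multicircle. -/
theorem IsMulticircle.surgery [T2Space F] {Z E₀ E₁ B₀ B₁ : Set F} {a b c d : F}
    (hZ : IsMulticircle Z) (hE₀ : IsArc E₀ a b) (hE₁ : IsArc E₁ c d) (hB₀ : IsArc B₀ a c)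
    (hB₁ : IsArc B₁ b d) (h₀ : E₀ ⊆ Z) (h₁ : E₁ ⊆ Z) (hE : E₀ ∩ E₁ = ∅) (hB : B₀ ∩ B₁ = ∅)
    (hB₀Z : B₀ ∩ Z ⊆ {a, c}) (hB₁Z : B₁ ∩ Z ⊆ {b, d}) :
    IsMulticircle ((Z \ (E₀ \ {a, b} ∪ E₁ \ {c, d})) ∪ (B₀ ∪ B₁)) := by
  have ma := hE₀.left_mem
  have mb := hE₀.right_mem
  have mc := hE₁.left_mem
  have md := hE₁.right_mem
  have ma' := hB₀.left_mem
  have mc' := hB₀.right_mem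
  have mb' := hB₁.left_mem
  have md' := hB₁.right_mem
  obtain ⟨C, R, hC, hR, hCR, rfl, hEC⟩ := hZ.split_off hE₀.isPreconnected h₀ ⟨a, ma⟩
  obtain ⟨S, hS, hSU, hSI⟩ := hC.compl_arc hE₀ hEC
  simp only [Set.ext_iff, Set.subset_def, mem_inter_iff, mem_union, mem_empty_iff_false,
    mem_insert_iff, mem_singleton_iff] at *
  by_cases hcC : c ∈ C
  · have hE₁C : E₁ ⊆ C := subset_of_closed_split hE₁.isPreconnected hC.isCompact.isClosed
      hR.isClosed (by ext x; simpa using hCR x) (fun x hx => h₁ x hx) ⟨c, mc, hcC⟩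
    have hE₁S : E₁ ⊆ S := by intro x hx; have := hE₁C hx; grind
    obtain ⟨S₁, S₂, hor, hU, hI₁, hI₂, hI⟩ := hS.compl_arc hE₁ hE₁S (by grind) (by grind)
    simp only [Set.ext_iff, Set.subset_def, mem_inter_iff, mem_union, mem_empty_iff_false,
      mem_insert_iff, mem_singleton_iff] at *
    rcases hor with ⟨k₁, k₂⟩ | ⟨k₁, k₂⟩
    · -- one circle
      have l₁ := k₁.left_mem
      have l₂ := k₁.right_mem
      have l₃ := k₂.left_mem
      have l₄ := k₂.right_mem
      have g₁ : IsArc (S₁ ∪ B₀) b a := k₁.trans hB₀.symm (by intro x hx; simp at *; grind)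
      have g₂ : IsArc (S₂ ∪ B₁) a b := (k₂.symm.trans hB₁.symm (by intro x hx; simp at *; grind))
      have g : IsEmbeddedCircle ((S₁ ∪ B₀) ∪ (S₂ ∪ B₁)) :=
        isEmbeddedCircle_of_arcs g₁ g₂ (by intro x hx; simp at *; grind)
      convert g.isMulticircle.union hR ?_ using 1
      · ext x; simp only [mem_union, mem_sdiff, mem_insert_iff, mem_singleton_iff]; grind
      · rw [Set.disjoint_left]; intro x hx; simp at *; grind
    · have l₁ := k₁.left_mem
      have l₂ := k₁.right_mem
      have l₃ := k₂.left_mem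
      have l₄ := k₂.right_mem
      have g₁ : IsEmbeddedCircle (S₁ ∪ B₁) :=
        isEmbeddedCircle_of_arcs k₁ hB₁.symm (by intro x hx; simp at *; grind)
      have g₂ : IsEmbeddedCircle (S₂ ∪ B₀) :=
        isEmbeddedCircle_of_arcs k₂ hB₀ (by intro x hx; simp at *; grind)
      convert (g₁.isMulticircle.union g₂.isMulticircle ?_).union hR ?_ using 1
      · ext x; simp only [mem_union, mem_sdiff, mem_insert_iff, mem_singleton_iff]; grind
      · rw [Set.disjoint_left]; intro x hx; simp at *; grind
      · rw [Set.disjoint_left]; intro x hx; simp at *; grind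
  · have hcR : c ∈ R := by grind
    have hE₁R : E₁ ⊆ R := subset_of_closed_split hE₁.isPreconnected hR.isClosed
      hC.isCompact.isClosed (by ext x; have := hCR x; simp; grind)
      (fun x hx => (h₁ x hx).symm) ⟨c, mc, hcR⟩
    obtain ⟨C', R', hC', hR', hCR', hRU, hEC'⟩ := hR.split_off hE₁.isPreconnected hE₁R ⟨c, mc⟩
    obtain ⟨S', hS', hSU', hSI'⟩ := hC'.compl_arc hE₁ hEC'
    simp only [Set.ext_iff, Set.subset_def, mem_inter_iff, mem_union, mem_empty_iff_false,
      mem_insert_iff, mem_singleton_iff] at *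
    have l₁ := hS.left_mem
    have l₂ := hS.right_mem
    have l₃ := hS'.left_mem
    have l₄ := hS'.right_mem
    have g₁ : IsArc (S ∪ B₀) b c := hS.trans hB₀ (by intro x hx; simp at *; grind)
    have g₂ : IsArc (S' ∪ B₁) c b := hS'.symm.trans hB₁.symm
      (by intro x hx; simp at *; grind)
    have g : IsEmbeddedCircle ((S ∪ B₀) ∪ (S' ∪ B₁)) :=
      isEmbeddedCircle_of_arcs g₁ g₂ (by intro x hx; simp at *; grind)
    convert g.isMulticircle.union hR' ?_ using 1
    · ext x; simp only [mem_union, mem_sdiff, mem_insert_iff, mem_singleton_iff]; grind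
    · rw [Set.disjoint_left]; intro x hx; simp at *; grind

/-- The connected components of a subset of `F`, as subsets of `F`. -/
def componentsOf (S : Set F) : Set (Set F) := {K | ∃ p ∈ S, K = connectedComponentIn S p}

theorem sUnion_componentsOf (S : Set F) : ⋃₀ componentsOf S = S := by
  apply Subset.antisymm
  · rintro x ⟨_, ⟨p, _, rfl⟩, hx⟩
    exact connectedComponentIn_subset S p hx
  · exact fun x hx => ⟨_, ⟨x, hx, rfl⟩, mem_connectedComponentIn hx⟩

theorem subset_of_mem_componentsOf {S K T : Set F} (hK : K ∈ componentsOf S)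
    (hT : IsPreconnected T) (hTS : T ⊆ S) (h : (T ∩ K).Nonempty) : T ⊆ K := by
  obtain ⟨p, _, rfl⟩ := hK
  obtain ⟨x, hxT, hxK⟩ := h
  rw [connectedComponentIn_eq hxK]
  exact hT.subset_connectedComponentIn hxT hTS

theorem finite_componentsOf {S : Set F} {𝒯 : Set (Set F)} (hf : 𝒯.Finite)
    (hc : ∀ T ∈ 𝒯, IsPreconnected T) (hS : S = ⋃₀ 𝒯) : (componentsOf S).Finite := by
  have key : ∀ K ∈ componentsOf S, ∃ T ∈ 𝒯, (T ∩ K).Nonempty := by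
    rintro _ ⟨p, hp, rfl⟩
    obtain ⟨T, hT, hpT⟩ := (hS ▸ hp : p ∈ ⋃₀ 𝒯)
    exact ⟨T, hT, p, hpT, mem_connectedComponentIn hp⟩
  choose! f hf1 hf2 using key
  refine Set.Finite.of_finite_image (f := f) (hf.subset (image_subset_iff.2 hf1)) ?_
  intro K hK L hL hKL
  have hs : ∀ K ∈ componentsOf S, f K ⊆ K := fun K hK =>
    subset_of_mem_componentsOf hK (hc _ (hf1 K hK))
      (by rw [hS]; exact subset_sUnion_of_mem (hf1 K hK)) (hf2 K hK)
  have hpre : ∀ K ∈ componentsOf S, IsPreconnected K ∧ K ⊆ S := by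
    rintro _ ⟨p, _, rfl⟩
    exact ⟨isPreconnected_connectedComponentIn, connectedComponentIn_subset _ _⟩
  obtain ⟨x, hx, _⟩ := hf2 K hK
  have hxK := hs K hK hx
  have hxL := hs L hL (hKL ▸ hx)
  exact Subset.antisymm
    (subset_of_mem_componentsOf hL (hpre K hK).1 (hpre K hK).2 ⟨x, hxK, hxL⟩)
    (subset_of_mem_componentsOf hK (hpre L hL).1 (hpre L hL).2 ⟨x, hxL, hxK⟩)

/-- In a union of two disjoint closed sets, components of the first are components of the union. -/
theorem componentsOf_union_left {X W : Set F} (hX : IsClosed X) (hW : IsClosed W)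
    (h : X ∩ W = ∅) : componentsOf X ⊆ componentsOf (X ∪ W) := by
  rintro _ ⟨p, hp, rfl⟩
  refine ⟨p, Or.inl hp, Subset.antisymm (connectedComponentIn_mono p subset_union_left) ?_⟩
  have hm : p ∈ connectedComponentIn (X ∪ W) p := mem_connectedComponentIn (Or.inl hp)
  exact isPreconnected_connectedComponentIn.subset_connectedComponentIn hm
    (subset_of_closed_split isPreconnected_connectedComponentIn hX hW h
      (connectedComponentIn_subset _ _) ⟨p, hm, hp⟩)

theorem componentsOf_sUnion [T2Space F] {𝒞 : Set (Set F)} (hf : 𝒞.Finite)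
    (hc : ∀ C ∈ 𝒞, IsEmbeddedCircle C) (hd : 𝒞.PairwiseDisjoint id) :
    componentsOf (⋃₀ 𝒞) = 𝒞 := by
  have key : ∀ C ∈ 𝒞, ∀ p ∈ C, connectedComponentIn (⋃₀ 𝒞) p = C := by
    intro C hC p hp
    have hm : p ∈ connectedComponentIn (⋃₀ 𝒞) p := mem_connectedComponentIn ⟨C, hC, hp⟩
    refine Subset.antisymm ?_ ((hc C hC).isConnected.isPreconnected.subset_connectedComponentIn hp
      (subset_sUnion_of_mem hC))
    have hR : IsMulticircle (⋃₀ (𝒞 \ {C})) :=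
      ⟨𝒞 \ {C}, hf.sdiff, fun D hD => hc D hD.1, hd.subset sdiff_subset, rfl⟩
    refine subset_of_closed_split isPreconnected_connectedComponentIn
      (hc C hC).isCompact.isClosed hR.isClosed ?_ ?_ ⟨p, hm, hp⟩
    · rw [← disjoint_iff_inter_eq_empty, disjoint_sUnion_right]
      exact fun D hD => hd hC hD.1 (fun h => hD.2 h.symm)
    · rw [← sUnion_insert, insert_sdiff_singleton, insert_eq_of_mem hC]
      exact connectedComponentIn_subset _ _
  ext K
  constructor
  · rintro ⟨p, ⟨C, hC, hp⟩, rfl⟩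
    rw [key C hC p hp]; exact hC
  · intro hK
    obtain ⟨p, hp⟩ := (hc K hK).isConnected.nonempty
    exact ⟨p, ⟨K, hK, hp⟩, (key K hK p hp).symm⟩

/-- The components of a multicircle are finitely many pairwise disjoint embedded circles. -/
theorem IsMulticircle.componentsOf [T2Space F] {Z : Set F} (hZ : IsMulticircle Z) :
    (componentsOf Z).Finite ∧ (∀ C ∈ componentsOf Z, IsEmbeddedCircle C) ∧
      (componentsOf Z).PairwiseDisjoint id := by
  obtain ⟨𝒞, h1, h2, h3, rfl⟩ := hZ
  rw [componentsOf_sUnion h1 h2 h3]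
  exact ⟨h1, h2, h3⟩

/-- An embedded arc in `F` together with a thin band around it: an embedded square `I × I` in `F`
whose middle line `I × {1/2}` is the arc. Surgery along an arc deletes a neighbourhood of its end
points and inserts two parallel copies of it; the band records which neighbourhood and which
parallel copies are used. -/
structure BandedArc (F : Type*) [TopologicalSpace F] where
  band : C(I × I, F)
  injective : Function.Injective band

namespace BandedArc

variable (a : BandedArc F)

/-- The arc itself. -/
def core : Set F := a.band '' {p | (p.2 : ℝ) = 1 / 2}

/-- The whole band. -/
def strip : Set F := range a.band

/-- The two ends `{0, 1} × I` of the band. -/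
def ends : Set F := a.band '' {p | p.1 = 0 ∨ p.1 = 1}

/-- The two open ends `{0, 1} × (0, 1)`: these neighbourhoods of the end points are deleted by
the surgery. -/
def openEnds : Set F := a.band '' {p | (p.1 = 0 ∨ p.1 = 1) ∧ 0 < p.2 ∧ p.2 < 1}

/-- The two sides `I × {0, 1}`: these parallel copies of the arc are inserted by the surgery. -/
def sides : Set F := a.band '' {p | p.2 = 0 ∨ p.2 = 1}

theorem core_subset_strip : a.core ⊆ a.strip := image_subset_range _ _
theorem ends_subset_strip : a.ends ⊆ a.strip := image_subset_range _ _
theorem sides_subset_strip : a.sides ⊆ a.strip := image_subset_range _ _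
theorem openEnds_subset_ends : a.openEnds ⊆ a.ends := image_mono fun _ h => h.1

/-- The middle parameter. -/
noncomputable def half : I := ⟨1 / 2, by norm_num, by norm_num⟩

theorem mem_core (u : I) : a.band (u, half) ∈ a.core := ⟨_, rfl, rfl⟩

theorem core_nonempty : a.core.Nonempty := ⟨_, a.mem_core 0⟩

theorem isPreconnected_core : IsPreconnected a.core := by
  have : a.core = range fun u : I => a.band (u, half) := by
    apply Subset.antisymm
    · rintro _ ⟨⟨u, v⟩, hv, rfl⟩
      have : v = half := Subtype.ext hv
      exact ⟨u, by rw [this]⟩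
    · rintro _ ⟨u, rfl⟩; exact a.mem_core u
  rw [this]
  exact isPreconnected_range (by fun_prop)

theorem isArc_end (u : I) :
    IsArc (a.band '' {p | p.1 = u}) (a.band (u, 0)) (a.band (u, 1)) := by
  refine ⟨⟨⟨fun v => a.band (u, v), by fun_prop⟩, rfl, rfl⟩, ?_, ?_⟩
  · intro v w h
    exact congrArg Prod.snd (a.injective h)
  · apply Subset.antisymm
    · rintro _ ⟨v, rfl⟩; exact ⟨(u, v), rfl, rfl⟩
    · rintro _ ⟨⟨u', v⟩, h, rfl⟩; exact ⟨v, by rw [← show u' = u from h]; rfl⟩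

theorem isArc_side (v : I) :
    IsArc (a.band '' {p | p.2 = v}) (a.band (0, v)) (a.band (1, v)) := by
  refine ⟨⟨⟨fun u => a.band (u, v), by fun_prop⟩, rfl, rfl⟩, ?_, ?_⟩
  · intro u w h
    exact congrArg Prod.fst (a.injective h)
  · apply Subset.antisymm
    · rintro _ ⟨u, rfl⟩; exact ⟨(u, v), rfl, rfl⟩
    · rintro _ ⟨⟨u, v'⟩, h, rfl⟩; exact ⟨u, by rw [← show v' = v from h]; rfl⟩

end BandedArc

/-- Embedded surgery on the subset `Z` of `F` along all arcs in `B`. -/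
def surgeredSet (Z : Set F) (B : Set (BandedArc F)) : Set F :=
  (Z \ ⋃ a ∈ B, a.openEnds) ∪ ⋃ a ∈ B, a.sides

theorem isMulticircle_surgeredSet_singleton [T2Space F] {Z : Set F} (hZ : IsMulticircle Z)
    {a : BandedArc F} (ha : a.strip ∩ Z = a.ends) : IsMulticircle (surgeredSet Z {a}) := by
  have hsub : a.ends ⊆ Z := ha ▸ inter_subset_right
  have hdis : ∀ s t : Set (I × I), s ∩ t = ∅ → (a.band '' s) ∩ (a.band '' t) = ∅ := by
    intro s t h
    rw [← image_inter a.injective, h, image_empty]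
  have hside : ∀ v : I, (a.band '' {p | p.2 = v}) ∩ Z ⊆ {a.band (0, v), a.band (1, v)} := by
    rintro v _ ⟨⟨⟨u, w⟩, hw, rfl⟩, hx⟩
    obtain ⟨⟨u', w'⟩, h, he⟩ := (ha ▸ ⟨mem_range_self _, hx⟩ : a.band (u, w) ∈ a.ends)
    obtain ⟨rfl, rfl⟩ := Prod.ext_iff.1 (a.injective he)
    simp only [mem_ofPred_eq] at h hw
    rcases h with h | h
    · left; rw [h, hw]
    · right; rw [h, hw]; rfl
  have he : ∀ f : I × I → I, {p | f p = 0} ∩ {p | f p = 1} = ∅ := by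
    intro f
    ext p
    simp only [mem_inter_iff, mem_ofPred_eq, mem_empty_iff_false, iff_false, not_and]
    intro h
    rw [h]
    exact zero_ne_one
  have key := hZ.surgery (a.isArc_end 0) (a.isArc_end 1) (a.isArc_side 0) (a.isArc_side 1)
    ((image_mono fun p hp => Or.inl hp).trans hsub) ((image_mono fun p hp => Or.inr hp).trans hsub)
    (hdis _ _ (he Prod.fst)) (hdis _ _ (he Prod.snd))
    (hside 0) (hside 1)
  have hopen : ∀ u : I, a.band '' {p | p.1 = u} \ {a.band (u, 0), a.band (u, 1)} =
      a.band '' {p | p.1 = u ∧ 0 < p.2 ∧ p.2 < 1} := by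
    intro u
    ext x
    constructor
    · rintro ⟨⟨⟨u', v⟩, h, rfl⟩, hx⟩
      have h' : u' = u := h
      subst h'
      refine ⟨(u', v), ⟨rfl, ?_, ?_⟩, rfl⟩
      · refine lt_of_le_of_ne v.2.1 fun h => hx (Or.inl ?_)
        rw [show v = 0 from h.symm]
      · refine lt_of_le_of_ne v.2.2 fun h => hx (Or.inr ?_)
        rw [show v = 1 from h]; rfl
    · rintro ⟨⟨u', v⟩, ⟨h, h0, h1⟩, rfl⟩
      refine ⟨⟨(u', v), h, rfl⟩, ?_⟩
      rintro (h | h)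
      · exact h0.ne' (congrArg Prod.snd (a.injective h))
      · exact h1.ne (congrArg Prod.snd (a.injective h))
  convert key using 1
  rw [hopen, hopen, surgeredSet, biUnion_singleton, biUnion_singleton, ← image_union,
    ← image_union, BandedArc.openEnds, BandedArc.sides]
  congr 3
  ext p
  simp only [mem_ofPred_eq, mem_union]
  tauto

theorem surgeredSet_insert {Z : Set F} {B : Set (BandedArc F)} {a : BandedArc F}
    (h : ∀ b ∈ B, Disjoint a.strip b.strip) :
    surgeredSet Z (insert a B) = surgeredSet (surgeredSet Z B) {a} := by
  have hd : ∀ b ∈ B, ∀ x ∈ b.sides, x ∉ a.openEnds := fun b hb x hx hx' =>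
    Set.disjoint_left.1 (h b hb) (a.ends_subset_strip (a.openEnds_subset_ends hx'))
      (b.sides_subset_strip hx)
  ext x
  simp only [surgeredSet, mem_union, mem_sdiff, biUnion_insert, biUnion_singleton, mem_iUnion,
    exists_prop]
  constructor
  · rintro (⟨h1, h2⟩ | h1 | ⟨b, hb, hx⟩)
    · exact Or.inl ⟨Or.inl ⟨h1, fun h => h2 (Or.inr h)⟩, fun h => h2 (Or.inl h)⟩
    · exact Or.inr h1
    · exact Or.inl ⟨Or.inr ⟨b, hb, hx⟩, hd b hb x hx⟩
  · rintro (⟨⟨h1, h2⟩ | h1, h3⟩ | h1)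
    · exact Or.inl ⟨h1, fun h => h.elim h3 h2⟩
    · exact Or.inr (Or.inr h1)
    · exact Or.inr (Or.inl h1)

theorem strip_inter_surgeredSet {Z : Set F} {B : Set (BandedArc F)} {a : BandedArc F}
    (h : ∀ b ∈ B, Disjoint a.strip b.strip) : a.strip ∩ surgeredSet Z B = a.strip ∩ Z := by
  ext x
  simp only [surgeredSet, mem_inter_iff, mem_union, mem_sdiff, mem_iUnion, exists_prop]
  constructor
  · rintro ⟨h1, ⟨h2, _⟩ | ⟨b, hb, hx⟩⟩
    · exact ⟨h1, h2⟩
    · exact absurd (b.sides_subset_strip hx) (Set.disjoint_left.1 (h b hb) h1)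
  · rintro ⟨h1, h2⟩
    refine ⟨h1, Or.inl ⟨h2, ?_⟩⟩
    rintro ⟨b, hb, hx⟩
    exact Set.disjoint_left.1 (h b hb) h1 (b.ends_subset_strip (b.openEnds_subset_ends hx))

theorem isMulticircle_surgeredSet [T2Space F] {Z : Set F} (hZ : IsMulticircle Z)
    {B : Set (BandedArc F)} (hB : B.Finite) (hd : B.Pairwise fun a b => Disjoint a.strip b.strip)
    (hi : ∀ a ∈ B, a.strip ∩ Z = a.ends) : IsMulticircle (surgeredSet Z B) := by
  induction B, hB using Set.Finite.induction_on with
  | empty => simpa [surgeredSet] using hZ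
  | @insert a B ha _ ih =>
    have hab : ∀ b ∈ B, Disjoint a.strip b.strip := fun b hb =>
      hd (mem_insert a B) (mem_insert_of_mem a hb) (fun h => ha (h ▸ hb))
    rw [surgeredSet_insert hab]
    refine isMulticircle_surgeredSet_singleton (ih (hd.mono (subset_insert a B))
      fun b hb => hi b (mem_insert_of_mem a hb)) ?_
    rw [strip_inter_surgeredSet hab, hi a (mem_insert a B)]

/-- A resolution configuration on `F`: finitely many pairwise disjoint embedded circles and an
ordered collection of disjoint embedded arcs (with their bands) that meet the circles exactly in
their end points (the bands exactly in their ends). -/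
structure ResolutionConfiguration (F : Type*) [TopologicalSpace F] where
  circles : Set (Set F)
  arcs : List (BandedArc F)
  finite_circles : circles.Finite
  isEmbeddedCircle : ∀ C ∈ circles, IsEmbeddedCircle C
  disjoint_circles : circles.PairwiseDisjoint id
  disjoint_arcs : arcs.Pairwise fun a b => Disjoint a.strip b.strip
  strip_inter : ∀ a ∈ arcs, a.strip ∩ ⋃₀ circles = a.ends

namespace ResolutionConfiguration

theorem disjoint_strip (D : ResolutionConfiguration F) {a b : BandedArc F} (ha : a ∈ D.arcs)
    (hb : b ∈ D.arcs) (hab : a ≠ b) : Disjoint a.strip b.strip := by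
  have : Std.Symm fun a b : BandedArc F => Disjoint a.strip b.strip := ⟨fun _ _ h => h.symm⟩
  exact D.disjoint_arcs.forall ha hb hab

noncomputable instance (D : ResolutionConfiguration F) : Fintype D.circles :=
  D.finite_circles.fintype

/-- The index: the number of arcs. -/
def ind (D : ResolutionConfiguration F) : ℕ := D.arcs.length

/-- The union of all circles. -/
def curve (D : ResolutionConfiguration F) : Set F := ⋃₀ D.circles

theorem isMulticircle_curve (D : ResolutionConfiguration F) : IsMulticircle D.curve :=
  ⟨D.circles, D.finite_circles, D.isEmbeddedCircle, D.disjoint_circles, rfl⟩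

theorem isMulticircle_surgered [T2Space F] (D : ResolutionConfiguration F)
    (A : Set (BandedArc F)) : IsMulticircle (surgeredSet D.curve {a | a ∈ D.arcs ∧ a ∈ A}) :=
  isMulticircle_surgeredSet D.isMulticircle_curve
    (D.arcs.finite_toSet.subset fun _ h => h.1)
    (fun _ ha _ hb hab => D.disjoint_strip ha.1 hb.1 hab) fun a ha => D.strip_inter a ha.1

open Classical in
/-- The surgery `s_A(D)` of `D` along the arcs of `D` that lie in `A`: its circles are the
connected components of the surgered curve, its arcs are the arcs of `D` not in `A`. -/
noncomputable def surgery [T2Space F] (D : ResolutionConfiguration F)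
    (A : Finset (BandedArc F)) : ResolutionConfiguration F where
  circles := componentsOf (surgeredSet D.curve {a | a ∈ D.arcs ∧ a ∈ A})
  arcs := D.arcs.filter fun a => a ∉ A
  finite_circles := (D.isMulticircle_surgered A).componentsOf.1
  isEmbeddedCircle := (D.isMulticircle_surgered A).componentsOf.2.1
  disjoint_circles := (D.isMulticircle_surgered A).componentsOf.2.2
  disjoint_arcs := D.disjoint_arcs.filter _
  strip_inter := by
    intro a ha
    obtain ⟨h1, h2⟩ : a ∈ D.arcs ∧ a ∉ A := by simpa using ha
    rw [sUnion_componentsOf, strip_inter_surgeredSet, curve, D.strip_inter a h1]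
    exact fun b hb => D.disjoint_strip h1 hb.1 fun h => h2 (h ▸ hb.2)

open Classical in
/-- The maximal surgery `s(D)`, along all arcs. -/
noncomputable def maxSurgery [T2Space F] (D : ResolutionConfiguration F) :
    ResolutionConfiguration F := D.surgery D.arcs.toFinset

/-- The union of all circles and arcs. -/
def support (D : ResolutionConfiguration F) : Set F := D.curve ∪ ⋃ a ∈ D.arcs, a.core

/-- The connected components of the graph formed by the circles and the arcs. -/
def components (D : ResolutionConfiguration F) : Set (Set F) := componentsOf D.support

theorem finite_components (D : ResolutionConfiguration F) : D.components.Finite := by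
  refine finite_componentsOf (𝒯 := D.circles ∪ BandedArc.core '' {a | a ∈ D.arcs})
    (D.finite_circles.union (D.arcs.finite_toSet.image _)) ?_ ?_
  · rintro T (hT | ⟨a, _, rfl⟩)
    · exact (D.isEmbeddedCircle T hT).isConnected.isPreconnected
    · exact a.isPreconnected_core
  · rw [sUnion_union, sUnion_image]; rfl

noncomputable instance (D : ResolutionConfiguration F) : Fintype D.components :=
  D.finite_components.fintype

/-- A set that contains or misses each circle and each arc. -/
def IsSaturated (D : ResolutionConfiguration F) (K : Set F) : Prop :=
  (∀ C ∈ D.circles, C ⊆ K ∨ Disjoint C K) ∧ ∀ a ∈ D.arcs, a.core ⊆ K ∨ Disjoint a.core K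

theorem isSaturated_of_mem_components (D : ResolutionConfiguration F) {K : Set F}
    (hK : K ∈ D.components) : D.IsSaturated K := by
  constructor
  · intro C hC
    rw [or_iff_not_imp_right, Set.not_disjoint_iff_nonempty_inter]
    exact subset_of_mem_componentsOf hK (D.isEmbeddedCircle C hC).isConnected.isPreconnected
      ((subset_sUnion_of_mem hC).trans subset_union_left)
  · intro a ha
    rw [or_iff_not_imp_right, Set.not_disjoint_iff_nonempty_inter]
    exact subset_of_mem_componentsOf hK a.isPreconnected_core
      ((subset_biUnion_of_mem (u := BandedArc.core) (s := {a | a ∈ D.arcs}) ha).trans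
        subset_union_right)

theorem circle_subset_support (D : ResolutionConfiguration F) {C : Set F} (hC : C ∈ D.circles) :
    C ⊆ D.support := (subset_sUnion_of_mem hC).trans subset_union_left

theorem core_subset_support (D : ResolutionConfiguration F) {a : BandedArc F} (ha : a ∈ D.arcs) :
    a.core ⊆ D.support :=
  (subset_biUnion_of_mem (u := BandedArc.core) (s := {a | a ∈ D.arcs}) ha).trans subset_union_right

theorem IsSaturated.compl {D : ResolutionConfiguration F} {K : Set F} (hK : D.IsSaturated K) :
    D.IsSaturated Kᶜ :=
  ⟨fun C hC => (hK.1 C hC).symm.imp subset_compl_iff_disjoint_right.2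
      fun h => disjoint_compl_right_iff_subset.2 h,
    fun a ha => (hK.2 a ha).symm.imp subset_compl_iff_disjoint_right.2
      fun h => disjoint_compl_right_iff_subset.2 h⟩

/-- An arc inside a saturated set ends on circles inside that set. -/
theorem IsSaturated.ends_subset [T2Space F] {D : ResolutionConfiguration F} {K : Set F}
    (hK : D.IsSaturated K) {a : BandedArc F} (ha : a ∈ D.arcs) (haK : a.core ⊆ K) :
    a.ends ⊆ ⋃₀ {C ∈ D.circles | C ⊆ K} := by
  have hends : a.ends ⊆ ⋃₀ D.circles := by
    rw [← D.strip_inter a ha]; exact inter_subset_right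
  have key : ∀ u : I, u = 0 ∨ u = 1 →
      a.band '' {p | p.1 = u} ⊆ ⋃₀ {C ∈ D.circles | C ⊆ K} := by
    intro u hu
    have hsub : a.band '' {p | p.1 = u} ⊆ ⋃₀ D.circles := by
      rintro _ ⟨⟨u', v⟩, hp, rfl⟩
      have hp' : u' = u := hp
      exact hends ⟨(u', v), hp' ▸ hu, rfl⟩
    have hmid : a.band (u, BandedArc.half) ∈ a.band '' {p | p.1 = u} := ⟨_, rfl, rfl⟩
    obtain ⟨C, hC, hxC⟩ := hsub hmid
    have hCE : a.band '' {p | p.1 = u} ⊆ C :=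
      subset_of_mem_componentsOf
        (by rwa [componentsOf_sUnion D.finite_circles D.isEmbeddedCircle D.disjoint_circles])
        (a.isArc_end u).isPreconnected hsub ⟨_, hmid, hxC⟩
    refine hCE.trans (subset_sUnion_of_mem ⟨hC, (hK.1 C hC).resolve_right fun h => ?_⟩)
    exact Set.disjoint_left.1 h hxC (haK (a.mem_core u))
  rintro _ ⟨p, hp, rfl⟩
  exact key p.1 hp ⟨p, rfl, rfl⟩

open Classical in
/-- The part of a resolution configuration that lies in a saturated set. -/
noncomputable def restrict [T2Space F] (D : ResolutionConfiguration F) (K : Set F)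
    (hK : D.IsSaturated K) : ResolutionConfiguration F where
  circles := {C ∈ D.circles | C ⊆ K}
  arcs := D.arcs.filter fun a => a.core ⊆ K
  finite_circles := D.finite_circles.subset fun _ h => h.1
  isEmbeddedCircle := fun C h => D.isEmbeddedCircle C h.1
  disjoint_circles := D.disjoint_circles.subset fun _ h => h.1
  disjoint_arcs := D.disjoint_arcs.filter _
  strip_inter := by
    intro a ha
    obtain ⟨h1, h2⟩ : a ∈ D.arcs ∧ a.core ⊆ K := by simpa using ha
    refine Subset.antisymm ?_ (subset_inter a.ends_subset_strip (hK.ends_subset h1 h2))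
    rw [← D.strip_inter a h1]
    exact inter_subset_inter_right _ (sUnion_mono fun _ h => h.1)

theorem mem_restrict_arcs [T2Space F] {D : ResolutionConfiguration F} {K : Set F}
    {hK : D.IsSaturated K} {a : BandedArc F} :
    a ∈ (D.restrict K hK).arcs ↔ a ∈ D.arcs ∧ a.core ⊆ K := by
  simp [restrict]

/-- The circles of `s(D|_K)` are circles of `s(D)`. -/
theorem maxSurgery_restrict_circles_subset [T2Space F] (D : ResolutionConfiguration F) (K : Set F)
    (hK : D.IsSaturated K) : (D.restrict K hK).maxSurgery.circles ⊆ D.maxSurgery.circles := by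
  classical
  have hcirc : ∀ E : ResolutionConfiguration F, E.maxSurgery.circles =
      componentsOf (surgeredSet E.curve {a | a ∈ E.arcs}) := by
    intro E
    simp [maxSurgery, surgery]
  have hmult : ∀ E : ResolutionConfiguration F,
      IsClosed (surgeredSet E.curve {a | a ∈ E.arcs}) := by
    intro E
    have := (E.isMulticircle_surgered univ).isClosed
    simpa using this
  set X := D.restrict K hK
  set W := D.restrict Kᶜ hK.compl
  have hXa : ∀ a, a ∈ X.arcs ↔ a ∈ D.arcs ∧ a.core ⊆ K := fun a => mem_restrict_arcs
  have hWa : ∀ a, a ∈ W.arcs ↔ a ∈ D.arcs ∧ a.core ⊆ Kᶜ := fun a => mem_restrict_arcs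
  have hXK : X.curve ⊆ K := sUnion_subset fun C hC => hC.2
  have hWK : W.curve ⊆ Kᶜ := sUnion_subset fun C hC => hC.2
  have hcurve : D.curve = X.curve ∪ W.curve := by
    apply Subset.antisymm
    · rintro x ⟨C, hC, hx⟩
      rcases hK.1 C hC with h | h
      · exact Or.inl ⟨C, ⟨hC, h⟩, hx⟩
      · exact Or.inr ⟨C, ⟨hC, subset_compl_iff_disjoint_right.2 h⟩, hx⟩
    · rintro x (⟨C, hC, hx⟩ | ⟨C, hC, hx⟩) <;> exact ⟨C, hC.1, hx⟩
  have harcs : ∀ a, a ∈ D.arcs ↔ a ∈ X.arcs ∨ a ∈ W.arcs := by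
    intro a
    rw [hXa, hWa, ← and_or_left, subset_compl_iff_disjoint_right]
    exact ⟨fun h => ⟨h, hK.2 a h⟩, fun h => h.1⟩
  have hstrip : ∀ a ∈ X.arcs, ∀ b ∈ W.arcs, Disjoint a.strip b.strip := by
    intro a ha b hb
    refine D.disjoint_strip ((hXa a).1 ha).1 ((hWa b).1 hb).1 ?_
    rintro rfl
    obtain ⟨x, hx⟩ := a.core_nonempty
    exact ((hWa a).1 hb).2 hx (((hXa a).1 ha).2 hx)
  have hXW : ∀ a ∈ X.arcs, ∀ x ∈ a.strip, x ∉ W.curve := by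
    intro a ha x hx hxW
    have h1 : x ∈ a.ends := by
      rw [← D.strip_inter a ((hXa a).1 ha).1]
      exact ⟨hx, show x ∈ D.curve by rw [hcurve]; exact Or.inr hxW⟩
    exact hWK hxW (hXK (hK.ends_subset ((hXa a).1 ha).1 ((hXa a).1 ha).2 h1))
  have hWX : ∀ a ∈ W.arcs, ∀ x ∈ a.strip, x ∉ X.curve := by
    intro a ha x hx hxX
    have h1 : x ∈ a.ends := by
      rw [← D.strip_inter a ((hWa a).1 ha).1]
      exact ⟨hx, show x ∈ D.curve by rw [hcurve]; exact Or.inl hxX⟩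
    exact hWK (hK.compl.ends_subset ((hWa a).1 ha).1 ((hWa a).1 ha).2 h1) (hXK hxX)
  have ho : ∀ a : BandedArc F, a.openEnds ⊆ a.strip := fun a =>
    a.openEnds_subset_ends.trans a.ends_subset_strip
  have hunion : surgeredSet D.curve {a | a ∈ D.arcs} =
      surgeredSet X.curve {a | a ∈ X.arcs} ∪ surgeredSet W.curve {a | a ∈ W.arcs} := by
    ext x
    simp only [surgeredSet, hcurve, mem_union, mem_sdiff, mem_iUnion, exists_prop, mem_ofPred_eq,
      harcs]
    constructor
    · rintro (⟨h1 | h1, h2⟩ | ⟨a, ha | ha, hx⟩)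
      · exact Or.inl (Or.inl ⟨h1, fun ⟨a, ha, hx⟩ => h2 ⟨a, Or.inl ha, hx⟩⟩)
      · exact Or.inr (Or.inl ⟨h1, fun ⟨a, ha, hx⟩ => h2 ⟨a, Or.inr ha, hx⟩⟩)
      · exact Or.inl (Or.inr ⟨a, ha, hx⟩)
      · exact Or.inr (Or.inr ⟨a, ha, hx⟩)
    · rintro ((⟨h1, h2⟩ | ⟨a, ha, hx⟩) | (⟨h1, h2⟩ | ⟨a, ha, hx⟩))
      · refine Or.inl ⟨Or.inl h1, ?_⟩
        rintro ⟨a, ha | ha, hx⟩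
        exacts [h2 ⟨a, ha, hx⟩, hWX a ha x (ho a hx) h1]
      · exact Or.inr ⟨a, Or.inl ha, hx⟩
      · refine Or.inl ⟨Or.inr h1, ?_⟩
        rintro ⟨a, ha | ha, hx⟩
        exacts [hXW a ha x (ho a hx) h1, h2 ⟨a, ha, hx⟩]
      · exact Or.inr ⟨a, Or.inr ha, hx⟩
  have hdisj : surgeredSet X.curve {a | a ∈ X.arcs} ∩ surgeredSet W.curve {a | a ∈ W.arcs} = ∅ := by
    rw [Set.eq_empty_iff_forall_notMem]
    intro x
    simp only [surgeredSet, mem_inter_iff, mem_union, mem_sdiff, mem_iUnion, exists_prop,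
      mem_ofPred_eq]
    rintro ⟨⟨h1, _⟩ | ⟨a, ha, hx⟩, ⟨h2, _⟩ | ⟨b, hb, hx'⟩⟩
    · exact hWK h2 (hXK h1)
    · exact hWX b hb x (b.sides_subset_strip hx') h1
    · exact hXW a ha x (a.sides_subset_strip hx) h2
    · exact Set.disjoint_left.1 (hstrip a ha b hb) (a.sides_subset_strip hx)
        (b.sides_subset_strip hx')
  rw [hcirc, hcirc, hunion]
  exact componentsOf_union_left (hmult X) (hmult W) hdisj

end ResolutionConfiguration

/-- The labels `x₊` and `x₋`. -/
inductive Label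
  | plus
  | minus

/-- The degree of a label: `deg x₊ = 1`, `deg x₋ = -1`. -/
def Label.deg : Label → ℤ
  | .plus => 1
  | .minus => -1

/-- Free homotopy of loops. -/
def freeHomotopySetoid (F : Type*) [TopologicalSpace F] : Setoid C(Circle, F) :=
  ⟨ContinuousMap.Homotopic, ContinuousMap.Homotopic.equivalence⟩

/-- The set `[S¹; F]` of free homotopy classes of loops in `F`. -/
def FreeLoopClass (F : Type*) [TopologicalSpace F] : Type _ := Quotient (freeHomotopySetoid F)

/-- The free homotopy class of a loop. -/
def loopClass (γ : C(Circle, F)) : FreeLoopClass F := Quotient.mk (freeHomotopySetoid F) γ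

/-- The loop with the opposite orientation. -/
noncomputable def reverseLoop (γ : C(Circle, F)) : C(Circle, F) := γ.comp ⟨fun z => z⁻¹, continuous_inv⟩

/-- The relations: contractible loops vanish, and a loop equals its reverse. -/
def homotopyRelations (F : Type*) [TopologicalSpace F] : Set (FreeAbelianGroup (FreeLoopClass F)) :=
  {r | ∃ p : F, r = FreeAbelianGroup.of (loopClass (ContinuousMap.const Circle p))} ∪
    {r | ∃ γ : C(Circle, F), r = FreeAbelianGroup.of (loopClass γ) -
      FreeAbelianGroup.of (loopClass (reverseLoop γ))}

/-- The group of values of the homotopical grading. -/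
abbrev HomotopyGroup (F : Type*) [TopologicalSpace F] : Type _ :=
  FreeAbelianGroup (FreeLoopClass F) ⧸ AddSubgroup.closure (homotopyRelations F)

/-- The class of an embedded circle. Any two parametrizations of the circle are homotopic up to a
change of orientation, so that the class does not depend on the chosen one. -/
noncomputable def circleClass (C : Set F) (hC : IsEmbeddedCircle C) : HomotopyGroup F :=
  QuotientAddGroup.mk (FreeAbelianGroup.of (loopClass hC.choose))

/-- A labeled resolution configuration. -/
structure LabeledConfiguration (F : Type*) [TopologicalSpace F] where
  config : ResolutionConfiguration F
  label : config.circles → Label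

namespace LabeledConfiguration

/-- The quantum grading, up to a constant: every surgery lowers the index, hence raises
`-ind`, by one. Only equality of quantum gradings of configurations that arise from each other by
surgery is used, and there the additive constant cancels. -/
noncomputable def quantumGrading (s : LabeledConfiguration F) : ℤ :=
  -(s.config.ind : ℤ) + ∑ C : s.config.circles, (s.label C).deg

/-- The homotopical grading. -/
noncomputable def homotopicalGrading (s : LabeledConfiguration F) : HomotopyGroup F :=
  ∑ C : s.config.circles, (s.label C).deg • circleClass C.1 (s.config.isEmbeddedCircle C.1 C.2)

/-- The elementary relation: `t` arises from `s` by surgery along a single arc, the labelings agree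
on the common circles, and both gradings are preserved. -/
def Step [T2Space F] (s t : LabeledConfiguration F) : Prop :=
  (∃ a ∈ s.config.arcs, t.config = s.config.surgery {a}) ∧
    (∀ (C : Set F) (hs : C ∈ s.config.circles) (ht : C ∈ t.config.circles),
      s.label ⟨C, hs⟩ = t.label ⟨C, ht⟩) ∧
    s.quantumGrading = t.quantumGrading ∧ s.homotopicalGrading = t.homotopicalGrading

/-- The partial order generated by the elementary relation. -/
def Prec [T2Space F] : LabeledConfiguration F → LabeledConfiguration F → Prop :=
  Relation.ReflTransGen Step

end LabeledConfiguration

/-- A decorated resolution configuration `(D, x, y)`: a labeling `x` of the circles of `s(D)` and a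
labeling `y` of the circles of `D`. -/
structure DecoratedConfiguration (F : Type*) [TopologicalSpace F] [T2Space F] where
  config : ResolutionConfiguration F
  finalLabel : config.maxSurgery.circles → Label
  initialLabel : config.circles → Label

namespace DecoratedConfiguration

variable [T2Space F]

/-- The initial configuration `(D, y)`. -/
def initial (𝒟 : DecoratedConfiguration F) : LabeledConfiguration F :=
  ⟨𝒟.config, 𝒟.initialLabel⟩

/-- The final configuration `(s(D), x)`. -/
noncomputable def final (𝒟 : DecoratedConfiguration F) : LabeledConfiguration F :=
  ⟨𝒟.config.maxSurgery, 𝒟.finalLabel⟩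

/-- The poset `P(D, x, y)` of labeled configurations between the initial and the final one. -/
def poset (𝒟 : DecoratedConfiguration F) : Set (LabeledConfiguration F) :=
  {s | LabeledConfiguration.Prec 𝒟.initial s ∧ LabeledConfiguration.Prec s 𝒟.final}

/-- The multiplicity of `s_A(D)`: the number of its labelings that belong to `P(D, x, y)`. -/
noncomputable def multiplicityAt (𝒟 : DecoratedConfiguration F) (A : Finset (BandedArc F)) : ℕ :=
  Nat.card {z : (𝒟.config.surgery A).circles → Label //
    (⟨𝒟.config.surgery A, z⟩ : LabeledConfiguration F) ∈ 𝒟.poset}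

open Classical in
/-- The multiplicity `μ(D, x, y)`: the maximum of the multiplicities of `s_A(D)` over all sets `A`
of arcs of `D`. -/
noncomputable def multiplicity (𝒟 : DecoratedConfiguration F) : ℕ :=
  𝒟.config.arcs.toFinset.powerset.sup 𝒟.multiplicityAt

/-- The connected component of a decorated resolution configuration with support `K`, with the
restricted labelings. -/
noncomputable def component (𝒟 : DecoratedConfiguration F) (K : 𝒟.config.components) :
    DecoratedConfiguration F where
  config := 𝒟.config.restrict K.1 (𝒟.config.isSaturated_of_mem_components K.2)
  finalLabel := fun C =>
    𝒟.finalLabel ⟨C.1, 𝒟.config.maxSurgery_restrict_circles_subset _ _ C.2⟩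
  initialLabel := fun C => 𝒟.initialLabel ⟨C.1, C.2.1⟩

end DecoratedConfiguration

end Resolution

/-! Before taking the maximum, the count is already multiplicative: for each fixed `A`, the number
of admissible labelings of `s_A(D)` is the product of the corresponding numbers for the components
(`multiplicityAt_eq_prod`). The maximum then factors because `A` amounts to an independent choice of
a set of arcs in each component.

The geometric input is that surgery happens inside the bands. A component of the graph of circles
and arcs, enlarged by the bands of its arcs, gives a set `D.thicken K`, and these sets are pairwise
disjoint (`isSplit_thicken`). The circles of `s_A(D)` are therefore distributed among these sets,
and those in one of them are the circles of the surgered component (`surgery_circles_eq_iUnion`,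
`part_surgery`). So a labeling of `s_A(D)` is the same as a family of labelings, one for each
component. Since a component may fall apart under surgery, the argument is run for an arbitrary
fixed splitting family `U` (`IsSplit`), which every surgery preserves.

The combinatorial input is that the order is a product order (`prec_iff_part`). An elementary
relation changes only the part that contains its arc. Both gradings are sums over the parts with
values in abelian groups, so cancelling the unchanged summands shows that the total grading is
preserved exactly when that of the changed part is. Hence elementary relations project to the parts
and lift from them (`Step.part`, `Step.lift`), and chains in the various parts can be carried out
one after another. -/

namespace Resolution

variable {F : Type*} [TopologicalSpace F] {ι : Type*}

/-! ### Components of disjoint unions, and cancellation in sums. -/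

/-- The components of a finite union of pairwise disjoint closed sets. -/
theorem componentsOf_iUnion [Finite ι] {S : ι → Set F} (hc : ∀ i, IsClosed (S i))
    (hd : Pairwise fun i j => Disjoint (S i) (S j)) :
    componentsOf (⋃ i, S i) = ⋃ i, componentsOf (S i) := by
  have key : ∀ i, componentsOf (S i) ⊆ componentsOf (⋃ i, S i) := by
    intro i
    have hU : ⋃ j, S j = S i ∪ ⋃ j ∈ {j | j ≠ i}, S j := by
      ext x
      simp only [mem_iUnion, mem_union, mem_ofPred_eq, exists_prop]
      constructor
      · rintro ⟨j, hj⟩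
        by_cases h : j = i
        · exact Or.inl (h ▸ hj)
        · exact Or.inr ⟨j, h, hj⟩
      · rintro (h | ⟨j, _, h⟩)
        exacts [⟨i, h⟩, ⟨j, h⟩]
    rw [hU]
    refine componentsOf_union_left (hc i) ((toFinite _).isClosed_biUnion fun j _ => hc j) ?_
    rw [← disjoint_iff_inter_eq_empty, disjoint_iUnion₂_right]
    exact fun j hj => hd (Ne.symm hj)
  refine Subset.antisymm ?_ (iUnion_subset key)
  rintro _ ⟨p, hp, rfl⟩
  obtain ⟨i, hi⟩ := mem_iUnion.1 hp
  -- The component of `S i` through `p` is some component of the whole union; as it contains `p`, it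
  -- is the one through `p`.
  obtain ⟨q, _, hq⟩ := key i ⟨p, hi, rfl⟩
  refine mem_iUnion.2 ⟨i, p, hi, ?_⟩
  rw [hq]
  exact (connectedComponentIn_eq (hq ▸ mem_connectedComponentIn hi)).symm

theorem eq_of_mem_componentsOf {S K L : Set F} (hK : K ∈ componentsOf S) (hL : L ∈ componentsOf S)
    {x : F} (hxK : x ∈ K) (hxL : x ∈ L) : K = L := by
  obtain ⟨p, _, rfl⟩ := hK
  obtain ⟨q, _, rfl⟩ := hL
  rw [connectedComponentIn_eq hxK, connectedComponentIn_eq hxL]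

theorem subset_of_mem_componentsOf' {S K : Set F} (h : K ∈ componentsOf S) : K ⊆ S := by
  obtain ⟨p, _, rfl⟩ := h
  exact connectedComponentIn_subset S p

/-- Two families that agree away from `i` have equal sums iff they agree at `i`. -/
theorem sum_eq_sum_iff_of_eq_of_ne {M : Type*} [AddCommGroup M] [Fintype ι] {f g : ι → M} {i : ι}
    (h : ∀ j, j ≠ i → f j = g j) : ∑ j, f j = ∑ j, g j ↔ f i = g i := by
  classical
  rw [← Finset.add_sum_erase _ f (Finset.mem_univ i), ← Finset.add_sum_erase _ g (Finset.mem_univ i),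
    Finset.sum_congr rfl fun j hj => h j (Finset.ne_of_mem_erase hj), add_left_inj]

/-! ### Split configurations: surgery respects the splitting. -/

namespace ResolutionConfiguration

theorem ext_of_mem {D E : ResolutionConfiguration F} (h : D.circles = E.circles)
    (h' : D.arcs = E.arcs) : D = E := by
  cases D; cases E; cases h; cases h'; rfl

/-- The family `U` of pairwise disjoint sets splits the configuration: every circle and every band
lies in one of them. -/
structure IsSplit (E : ResolutionConfiguration F) (U : ι → Set F) : Prop where
  disjoint : Pairwise fun i j => Disjoint (U i) (U j)
  circle : ∀ C ∈ E.circles, ∃ i, C ⊆ U i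
  strip : ∀ a ∈ E.arcs, ∃ i, a.strip ⊆ U i

variable {E : ResolutionConfiguration F} {U : ι → Set F}

theorem IsSplit.eq_of_mem (h : E.IsSplit U) {i j : ι} {x : F} (hi : x ∈ U i) (hj : x ∈ U j) :
    i = j := by
  by_contra hij
  exact Set.disjoint_left.1 (h.disjoint hij) hi hj

theorem IsSplit.circle_subset (h : E.IsSplit U) {C : Set F} (hC : C ∈ E.circles) {i : ι} {x : F}
    (hx : x ∈ C) (hi : x ∈ U i) : C ⊆ U i := by
  obtain ⟨j, hj⟩ := h.circle C hC
  rwa [h.eq_of_mem hi (hj hx)]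

theorem IsSplit.strip_subset (h : E.IsSplit U) {a : BandedArc F} (ha : a ∈ E.arcs) {i : ι} {x : F}
    (hx : x ∈ a.strip) (hi : x ∈ U i) : a.strip ⊆ U i := by
  obtain ⟨j, hj⟩ := h.strip a ha
  rwa [h.eq_of_mem hi (hj hx)]

theorem IsSplit.strip_subset_iff (h : E.IsSplit U) {a : BandedArc F} (ha : a ∈ E.arcs) {i : ι} :
    a.core ⊆ U i ↔ a.strip ⊆ U i := by
  obtain ⟨x, hx⟩ := a.core_nonempty
  exact ⟨fun hc => h.strip_subset ha (a.core_subset_strip hx) (hc hx),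
    fun hs => a.core_subset_strip.trans hs⟩

theorem IsSplit.isSaturated (h : E.IsSplit U) (i : ι) : E.IsSaturated (U i) := by
  constructor
  · intro C hC
    rw [or_iff_not_imp_right, Set.not_disjoint_iff]
    rintro ⟨x, hx, hi⟩
    exact h.circle_subset hC hx hi
  · intro a ha
    rw [or_iff_not_imp_right, Set.not_disjoint_iff]
    rintro ⟨x, hx, hi⟩
    exact a.core_subset_strip.trans (h.strip_subset ha (a.core_subset_strip hx) hi)

theorem circle_nonempty {C : Set F} (hC : C ∈ E.circles) : C.Nonempty :=
  (E.isEmbeddedCircle C hC).isConnected.nonempty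

variable [T2Space F]

/-- The part of a split configuration in one of the splitting sets. -/
noncomputable def part (h : E.IsSplit U) (i : ι) : ResolutionConfiguration F :=
  E.restrict (U i) (h.isSaturated i)

theorem mem_part_circles {h : E.IsSplit U} {i : ι} {C : Set F} :
    C ∈ (part h i).circles ↔ C ∈ E.circles ∧ C ⊆ U i := Iff.rfl

theorem mem_part_arcs (h : E.IsSplit U) {i : ι} {a : BandedArc F} :
    a ∈ (part h i).arcs ↔ a ∈ E.arcs ∧ a.strip ⊆ U i := by
  rw [part, mem_restrict_arcs]
  exact and_congr_right fun ha => h.strip_subset_iff ha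

theorem eq_of_mem_part_circles {h : E.IsSplit U} {i j : ι} {C : Set F}
    (hC : C ∈ (part h i).circles) (hCj : C ⊆ U j) : i = j := by
  obtain ⟨x, hx⟩ := circle_nonempty hC
  exact h.eq_of_mem (hC.2 hx) (hCj hx)

/-- Surgery along an arc changes the curve only inside its band, and a band that meets `U i` lies in
it. So only arcs of the part can delete or insert points in `U i`. This is why `IsSplit` asks for
whole bands and not just for cores. -/
theorem surgeredSet_part (h : E.IsSplit U) (i : ι) (A : Set (BandedArc F)) :
    surgeredSet (part h i).curve {a | a ∈ (part h i).arcs ∧ a ∈ A} =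
      surgeredSet E.curve {a | a ∈ E.arcs ∧ a ∈ A} ∩ U i := by
  have ho : ∀ a : BandedArc F, a.openEnds ⊆ a.strip := fun a =>
    a.openEnds_subset_ends.trans a.ends_subset_strip
  ext x
  simp only [surgeredSet, mem_union, mem_sdiff, mem_iUnion, exists_prop, mem_inter_iff,
    mem_ofPred_eq, mem_part_arcs, curve, mem_sUnion, mem_part_circles]
  constructor
  · rintro (⟨⟨C, ⟨hC, hCi⟩, hx⟩, hn⟩ | ⟨a, ⟨⟨ha, hai⟩, haA⟩, hx⟩)
    · refine ⟨Or.inl ⟨⟨C, hC, hx⟩, ?_⟩, hCi hx⟩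
      rintro ⟨a, ⟨ha, haA⟩, hxa⟩
      exact hn ⟨a, ⟨⟨ha, h.strip_subset ha (ho a hxa) (hCi hx)⟩, haA⟩, hxa⟩
    · exact ⟨Or.inr ⟨a, ⟨ha, haA⟩, hx⟩, hai (a.sides_subset_strip hx)⟩
  · rintro ⟨⟨⟨C, hC, hx⟩, hn⟩ | ⟨a, ⟨ha, haA⟩, hx⟩, hi⟩
    · refine Or.inl ⟨⟨C, ⟨hC, h.circle_subset hC hx hi⟩, hx⟩, ?_⟩
      rintro ⟨a, ⟨⟨ha, _⟩, haA⟩, hxa⟩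
      exact hn ⟨a, ⟨ha, haA⟩, hxa⟩
    · exact Or.inr ⟨a, ⟨⟨ha, h.strip_subset ha (a.sides_subset_strip hx) hi⟩, haA⟩, hx⟩

theorem surgeredSet_eq_iUnion (h : E.IsSplit U) (A : Set (BandedArc F)) :
    surgeredSet E.curve {a | a ∈ E.arcs ∧ a ∈ A} =
      ⋃ i, surgeredSet (part h i).curve {a | a ∈ (part h i).arcs ∧ a ∈ A} := by
  simp only [surgeredSet_part]
  rw [← inter_iUnion, left_eq_inter]
  rintro x (⟨⟨C, hC, hx⟩, _⟩ | hx)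
  · obtain ⟨i, hi⟩ := h.circle C hC
    exact mem_iUnion.2 ⟨i, hi hx⟩
  · simp only [mem_iUnion, exists_prop] at hx
    obtain ⟨a, ha, hx⟩ := hx
    obtain ⟨i, hi⟩ := h.strip a ha.1
    exact mem_iUnion.2 ⟨i, hi (a.sides_subset_strip hx)⟩

/-- The surgered curves of the parts are multicircles, hence closed, and they are separated by the
sets `U i`. No topological condition on the `U i` themselves is needed. -/
theorem surgery_circles_eq_iUnion [Finite ι] (h : E.IsSplit U) (A : Finset (BandedArc F)) :
    (E.surgery A).circles = ⋃ i, ((part h i).surgery A).circles := by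
  change componentsOf (surgeredSet E.curve {a | a ∈ E.arcs ∧ a ∈ (A : Set (BandedArc F))}) = _
  rw [surgeredSet_eq_iUnion h]
  refine componentsOf_iUnion (fun i => ((part h i).isMulticircle_surgered A).isClosed) ?_
  intro i j hij
  rw [surgeredSet_part, surgeredSet_part]
  exact (h.disjoint hij).mono inter_subset_right inter_subset_right

theorem subset_of_mem_part_surgery {h : E.IsSplit U} {i : ι} {A : Finset (BandedArc F)}
    {C : Set F} (hC : C ∈ ((part h i).surgery A).circles) : C ⊆ U i := by
  refine (subset_of_mem_componentsOf' hC).trans ?_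
  have := surgeredSet_part h i (A : Set (BandedArc F))
  simp only [Finset.mem_coe] at this
  rw [this]
  exact inter_subset_right

theorem mem_surgery_arcs {A : Finset (BandedArc F)} {a : BandedArc F} :
    a ∈ (E.surgery A).arcs ↔ a ∈ E.arcs ∧ a ∉ A := by
  simp [surgery]

/-- This allows one family `U` to serve along a whole chain of surgeries, although the connected
components may change at each of them. -/
theorem IsSplit.surgery [Finite ι] (h : E.IsSplit U) (A : Finset (BandedArc F)) :
    (E.surgery A).IsSplit U where
  disjoint := h.disjoint
  circle C hC := by
    rw [surgery_circles_eq_iUnion h] at hC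
    obtain ⟨i, hi⟩ := mem_iUnion.1 hC
    exact ⟨i, subset_of_mem_part_surgery hi⟩
  strip a ha := h.strip a (mem_surgery_arcs.1 ha).1

/-- Surgery commutes with passing to a part. -/
theorem part_surgery [Finite ι] (h : E.IsSplit U) (A : Finset (BandedArc F)) (i : ι) :
    part (h.surgery A) i = (part h i).surgery A := by
  classical
  apply ext_of_mem
  · ext C
    rw [mem_part_circles, surgery_circles_eq_iUnion h, mem_iUnion]
    constructor
    -- A circle that comes from part `j` is nonempty and lies in `U j`, so lying in `U i` as well
    -- forces `j = i`.
    · rintro ⟨⟨j, hj⟩, hi⟩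
      obtain ⟨x, hx⟩ := circle_nonempty hj
      rwa [h.eq_of_mem (hi hx) (subset_of_mem_part_surgery hj hx)]
    · exact fun hC => ⟨⟨i, hC⟩, subset_of_mem_part_surgery hC⟩
  · simp only [part, ResolutionConfiguration.surgery, restrict, List.filter_filter]
    exact List.filter_congr fun a _ => Bool.and_comm _ _

/-- A surgery depends only on the arcs of the configuration it uses. -/
theorem surgery_congr {A B : Finset (BandedArc F)} (h : ∀ a ∈ E.arcs, a ∈ A ↔ a ∈ B) :
    E.surgery A = E.surgery B := by
  classical
  apply ext_of_mem
  · simp only [ResolutionConfiguration.surgery]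
    congr 2
    ext a
    exact and_congr_right (h a)
  · simp only [ResolutionConfiguration.surgery]
    exact List.filter_congr fun a ha => by simp [h a ha]

/-- The curve is untouched, and the components of a disjoint union of circles are these circles.
Needed for the parts that do not contain the arc of a surgery. -/
theorem surgery_of_notMem {A : Finset (BandedArc F)} (h : ∀ a ∈ E.arcs, a ∉ A) :
    E.surgery A = E := by
  classical
  apply ext_of_mem
  · have h0 : {a | a ∈ E.arcs ∧ a ∈ A} = ∅ := by
      ext a
      simpa using h a
    simp only [ResolutionConfiguration.surgery, h0, surgeredSet, mem_empty_iff_false,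
      iUnion_of_empty, iUnion_empty, Set.sdiff_empty, union_empty]
    exact componentsOf_sUnion E.finite_circles E.isEmbeddedCircle E.disjoint_circles
  · simpa [ResolutionConfiguration.surgery] using h

/-- The circles of a split configuration are those of its parts. -/
noncomputable def circlesEquiv (h : E.IsSplit U) : (Σ i, (part h i).circles) ≃ E.circles :=
  Equiv.ofBijective (fun C => ⟨C.2.1, C.2.2.1⟩) <| by
    constructor
    · rintro ⟨i, C, hC⟩ ⟨j, C', hC'⟩ hCC
      obtain rfl : C = C' := congrArg Subtype.val hCC
      obtain rfl := eq_of_mem_part_circles hC hC'.2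
      rfl
    · rintro ⟨C, hC⟩
      obtain ⟨i, hi⟩ := h.circle C hC
      exact ⟨⟨i, C, hC, hi⟩, rfl⟩

theorem sum_circles [Fintype ι] {M : Type*} [AddCommMonoid M] (h : E.IsSplit U)
    (f : E.circles → M) :
    ∑ C, f C = ∑ i, ∑ C : (part h i).circles, f ⟨C.1, C.2.1⟩ := by
  rw [← Fintype.sum_sigma', ← (circlesEquiv h).sum_comp]
  rfl

theorem ind_eq_sum [Fintype ι] (h : E.IsSplit U) : E.ind = ∑ i, (part h i).ind := by
  classical
  -- Generalized to arbitrary lists of arcs of `E` to permit list induction; each arc adds one to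
  -- exactly one summand, because its core is nonempty and lies in a single `U i`.
  have key : ∀ l : List (BandedArc F), (∀ a ∈ l, a ∈ E.arcs) →
      l.length = ∑ i, (l.filter fun a => a.core ⊆ U i).length := by
    intro l hl
    induction l with
    | nil => simp
    | cons a l ih =>
      obtain ⟨i, hi⟩ := h.strip a (hl a List.mem_cons_self)
      have hj : ∀ j, (List.filter (fun b => decide (b.core ⊆ U j)) (a :: l)).length =
          (if j = i then 1 else 0) + (l.filter fun b => b.core ⊆ U j).length := by
        intro j
        have hji : a.core ⊆ U j ↔ j = i := by
          constructor
          · intro hc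
            obtain ⟨x, hx⟩ := a.core_nonempty
            exact h.eq_of_mem (hc hx) (hi (a.core_subset_strip hx))
          · rintro rfl
            exact a.core_subset_strip.trans hi
        rw [List.filter_cons]
        by_cases hc : j = i
        · rw [if_pos (decide_eq_true (hji.2 hc)), if_pos hc, List.length_cons, add_comm]
        · rw [if_neg (by simpa using mt hji.1 hc), if_neg hc, zero_add]
      simp only [hj, Finset.sum_add_distrib]
      rw [← ih fun b hb => hl b (List.mem_cons_of_mem a hb)]
      simp [add_comm]
  exact key _ fun _ ha => ha

end ResolutionConfiguration

/-! ### Labeled configurations: the gradings are additive and the order is a product. -/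

namespace LabeledConfiguration

/-- Comparing labels circle by circle avoids transporting a labeling along an equality of
configurations. -/
theorem ext_of_label {s t : LabeledConfiguration F} (h : s.config = t.config)
    (h' : ∀ (C : Set F) (hs : C ∈ s.config.circles) (ht : C ∈ t.config.circles),
      s.label ⟨C, hs⟩ = t.label ⟨C, ht⟩) : s = t := by
  obtain ⟨D, y⟩ := s
  obtain ⟨E, z⟩ := t
  cases h
  congr
  ext C
  exact h' C.1 C.2 C.2

theorem label_congr {s t : LabeledConfiguration F} (h : s = t) {C : Set F}
    (hs : C ∈ s.config.circles) (ht : C ∈ t.config.circles) :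
    s.label ⟨C, hs⟩ = t.label ⟨C, ht⟩ := by
  cases h; rfl

variable [T2Space F] {U : ι → Set F}

/-- The part of a labeled configuration in one of the splitting sets. -/
noncomputable def part (s : LabeledConfiguration F) (h : s.config.IsSplit U) (i : ι) :
    LabeledConfiguration F :=
  ⟨ResolutionConfiguration.part h i, fun C => s.label ⟨C.1, C.2.1⟩⟩

section gradings

variable [Fintype ι]

/-- Both the number of arcs and the sum of degrees are additive over the parts. -/
theorem quantumGrading_eq_sum (s : LabeledConfiguration F) (h : s.config.IsSplit U) :
    s.quantumGrading = ∑ i, (s.part h i).quantumGrading := by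
  simp only [quantumGrading, Finset.sum_add_distrib]
  rw [ResolutionConfiguration.ind_eq_sum h, ResolutionConfiguration.sum_circles h]
  simp only [Nat.cast_sum, Finset.sum_neg_distrib]
  rfl

theorem homotopicalGrading_eq_sum (s : LabeledConfiguration F) (h : s.config.IsSplit U) :
    s.homotopicalGrading = ∑ i, (s.part h i).homotopicalGrading := by
  simp only [homotopicalGrading]
  rw [ResolutionConfiguration.sum_circles h]
  rfl

end gradings

/-- Two labeled configurations with the same parts are equal, provided the arcs of both are
sublists of a common list. -/
theorem eq_of_part_eq {s t : LabeledConfiguration F} (hs : s.config.IsSplit U)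
    (ht : t.config.IsSplit U) (h : ∀ i, s.part hs i = t.part ht i) {l : List (BandedArc F)}
    {p q : BandedArc F → Bool} (hp : s.config.arcs = l.filter p) (hq : t.config.arcs = l.filter q) :
    s = t := by
  have hC : ∀ i C, (C ∈ s.config.circles ∧ C ⊆ U i ↔ C ∈ t.config.circles ∧ C ⊆ U i) := by
    intro i C
    rw [← ResolutionConfiguration.mem_part_circles (h := hs),
      ← ResolutionConfiguration.mem_part_circles (h := ht)]
    exact Set.ext_iff.1 (congrArg (fun r : LabeledConfiguration F => r.config.circles) (h i)) C
  have ha : ∀ i a, (a ∈ s.config.arcs ∧ a.strip ⊆ U i ↔ a ∈ t.config.arcs ∧ a.strip ⊆ U i) := by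
    intro i a
    rw [← ResolutionConfiguration.mem_part_arcs hs,
      ← ResolutionConfiguration.mem_part_arcs ht]
    exact iff_of_eq (congrArg (fun r : LabeledConfiguration F => a ∈ r.config.arcs) (h i))
  refine ext_of_label (ResolutionConfiguration.ext_of_mem ?_ ?_) ?_
  · ext C
    constructor
    · intro h1
      obtain ⟨i, hi⟩ := hs.circle C h1
      exact ((hC i C).1 ⟨h1, hi⟩).1
    · intro h1
      obtain ⟨i, hi⟩ := ht.circle C h1
      exact ((hC i C).2 ⟨h1, hi⟩).1
  -- The parts do not record how arcs of different parts are interleaved in the ordered list. Two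
  -- filters of the same list `l` with the same members are equal, which settles the order.
  · rw [hp, hq]
    refine List.filter_congr fun a hal => ?_
    have key : a ∈ s.config.arcs ↔ a ∈ t.config.arcs := by
      constructor
      · intro h1
        obtain ⟨i, hi⟩ := hs.strip a h1
        exact ((ha i a).1 ⟨h1, hi⟩).1
      · intro h1
        obtain ⟨i, hi⟩ := ht.strip a h1
        exact ((ha i a).2 ⟨h1, hi⟩).1
    rw [hp, hq, List.mem_filter, List.mem_filter, and_iff_right hal, and_iff_right hal] at key
    exact Bool.eq_iff_iff.2 key
  · intro C h1 h2
    obtain ⟨i, hi⟩ := hs.circle C h1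
    exact label_congr (h i) ⟨h1, hi⟩ ⟨h2, hi⟩

variable [Finite ι]

theorem Step.isSplit {s t : LabeledConfiguration F} (hst : Step s t) (h : s.config.IsSplit U) :
    t.config.IsSplit U := by
  obtain ⟨⟨a, _, hc⟩, _⟩ := hst
  rw [hc]
  exact h.surgery _

theorem Prec.isSplit {s t : LabeledConfiguration F} (hst : Prec s t) (h : s.config.IsSplit U) :
    t.config.IsSplit U := by
  induction hst with
  | refl => exact h
  | tail _ hs ih => exact hs.isSplit ih

/-- The form of `part_surgery` that applies to the target of a `Step`, whose configuration is a
surgery only up to a propositional equality. -/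
theorem part_config_of_surgery {s t : LabeledConfiguration F} (h : s.config.IsSplit U)
    (h' : t.config.IsSplit U) {A : Finset (BandedArc F)} (hc : t.config = s.config.surgery A)
    (i : ι) : (t.part h' i).config = (s.part h i).config.surgery A := by
  obtain ⟨E, z⟩ := t
  cases hc
  exact ResolutionConfiguration.part_surgery h A i

/-- An elementary relation is an elementary relation in one part and the identity elsewhere. -/
theorem part_eq_of_ne {s t : LabeledConfiguration F} (h : s.config.IsSplit U)
    (h' : t.config.IsSplit U) {a : BandedArc F} {i j : ι} (hai : a.strip ⊆ U i)
    (hc : t.config = s.config.surgery {a})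
    (hl : ∀ (C : Set F) (hs : C ∈ s.config.circles) (ht : C ∈ t.config.circles), C ⊆ U j →
      s.label ⟨C, hs⟩ = t.label ⟨C, ht⟩) (hij : j ≠ i) : s.part h j = t.part h' j := by
  have hcj : (s.part h j).config = (t.part h' j).config := by
    rw [part_config_of_surgery h h' hc, ResolutionConfiguration.surgery_of_notMem]
    intro b hb hba
    obtain rfl := Finset.mem_singleton.1 hba
    obtain ⟨x, hx⟩ := b.core_nonempty
    have hx' := b.core_subset_strip hx
    exact hij (h.eq_of_mem (((ResolutionConfiguration.mem_part_arcs h).1 hb).2 hx') (hai hx'))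
  exact ext_of_label hcj fun C hs ht => hl C hs.1 ht.1 hs.2

/-- The conclusion is `Prec` and not `Step` because a part without the surgery arc does not move. In
the part with the arc, preservation of the gradings follows by cancelling the summands of all other
parts. -/
theorem Step.part {s t : LabeledConfiguration F} (hst : Step s t) (h : s.config.IsSplit U)
    (h' : t.config.IsSplit U) (i : ι) : Prec (s.part h i) (t.part h' i) := by
  have := Fintype.ofFinite ι
  obtain ⟨⟨a, ha, hc⟩, hl, hq, hh⟩ := hst
  obtain ⟨j, hj⟩ := h.strip a ha
  have hne : ∀ k, k ≠ j → s.part h k = t.part h' k := fun k hk =>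
    part_eq_of_ne h h' hj hc (fun C hs ht _ => hl C hs ht) hk
  by_cases hij : i = j
  · subst hij
    refine Relation.ReflTransGen.single ⟨⟨a, ?_, part_config_of_surgery h h' hc i⟩, ?_, ?_, ?_⟩
    · exact (ResolutionConfiguration.mem_part_arcs h).2 ⟨ha, hj⟩
    · exact fun C hs ht => hl C hs.1 ht.1
    · rw [quantumGrading_eq_sum s h, quantumGrading_eq_sum t h'] at hq
      exact (sum_eq_sum_iff_of_eq_of_ne fun k hk => by rw [hne k hk]).1 hq
    · rw [homotopicalGrading_eq_sum s h, homotopicalGrading_eq_sum t h'] at hh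
      exact (sum_eq_sum_iff_of_eq_of_ne fun k hk => by rw [hne k hk]).1 hh
  · rw [hne i hij]
    exact Relation.ReflTransGen.refl

theorem Prec.part {s t : LabeledConfiguration F} (hst : Prec s t) (h : s.config.IsSplit U)
    (h' : t.config.IsSplit U) (i : ι) : Prec (s.part h i) (t.part h' i) := by
  induction hst with
  | refl => exact Relation.ReflTransGen.refl
  | @tail r t hr hs ih =>
    have hr' : r.config.IsSplit U := Prec.isSplit hr h
    exact (ih hr').trans (hs.part hr' h' i)

/-- An elementary relation in one part lifts to the whole configuration. -/
theorem Step.lift {s u : LabeledConfiguration F} (h : s.config.IsSplit U) {i : ι}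
    (hu : Step (s.part h i) u) : ∃ t, ∃ h' : t.config.IsSplit U, Step s t ∧ t.part h' i = u ∧
      ∀ j, j ≠ i → t.part h' j = s.part h j := by
  classical
  have := Fintype.ofFinite ι
  obtain ⟨⟨a, ha, hc⟩, hl, hq, hh⟩ := hu
  obtain ⟨ha, hai⟩ := (ResolutionConfiguration.mem_part_arcs h).1 ha
  -- Labels are taken from `u` in part `i` and from `s` elsewhere. The default `.plus` is never
  -- reached: a circle of the surgery lies either in part `i`, whose circles are those of `u`, or in
  -- a part that the surgery leaves unchanged.
  let t : LabeledConfiguration F := ⟨s.config.surgery {a}, fun C =>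
    if hC : C.1 ∈ u.config.circles then u.label ⟨C.1, hC⟩
    else if hC : C.1 ∈ s.config.circles then s.label ⟨C.1, hC⟩ else .plus⟩
  have h' : t.config.IsSplit U := h.surgery {a}
  have htc : (t.part h' i).config = u.config := by
    rw [hc]; exact part_config_of_surgery h h' rfl i
  have hti : t.part h' i = u := by
    refine ext_of_label htc fun C hs hu => ?_
    change dite _ _ _ = _
    rw [dif_pos hu]
  have hlab : ∀ (C : Set F) (hs : C ∈ s.config.circles) (ht : C ∈ t.config.circles),
      s.label ⟨C, hs⟩ = t.label ⟨C, ht⟩ := by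
    intro C hs ht
    -- A circle common to `s` and `t` that belongs to `u` lies in `U i`, so the agreement of labels
    -- given by the step in part `i` applies to it.
    by_cases hC : C ∈ u.config.circles
    · have hCi : C ⊆ U i := (htc.symm ▸ hC : C ∈ (t.part h' i).config.circles).2
      change _ = dite _ _ _
      rw [dif_pos hC]
      exact hl C ⟨hs, hCi⟩ hC
    · change _ = dite _ _ _
      rw [dif_neg hC, dif_pos hs]
  have hne : ∀ j, j ≠ i → s.part h j = t.part h' j := fun j hj =>
    part_eq_of_ne h h' hai rfl (fun C hs ht _ => hlab C hs ht) hj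
  refine ⟨t, h', ⟨⟨a, ha, rfl⟩, hlab, ?_, ?_⟩, hti, fun j hj => (hne j hj).symm⟩
  · rw [quantumGrading_eq_sum s h, quantumGrading_eq_sum t h',
      sum_eq_sum_iff_of_eq_of_ne fun k hk => by rw [hne k hk], hti, hq]
  · rw [homotopicalGrading_eq_sum s h, homotopicalGrading_eq_sum t h',
      sum_eq_sum_iff_of_eq_of_ne fun k hk => by rw [hne k hk], hti, hh]

/-- Lifted steps can be chained because each of them leaves the other parts fixed. -/
theorem Prec.lift {s u : LabeledConfiguration F} (h : s.config.IsSplit U) {i : ι}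
    (hu : Prec (s.part h i) u) : ∃ t, ∃ h' : t.config.IsSplit U, Prec s t ∧ t.part h' i = u ∧
      ∀ j, j ≠ i → t.part h' j = s.part h j := by
  induction hu with
  | refl => exact ⟨s, h, .refl, rfl, fun _ _ => rfl⟩
  | tail _ hs ih =>
    obtain ⟨r, hr, hsr, rfl, hne⟩ := ih
    obtain ⟨t, ht, hrt, hti, hne'⟩ := hs.lift hr
    exact ⟨t, ht, hsr.tail hrt, hti, fun j hj => (hne' j hj).trans (hne j hj)⟩

/-- Supplies the information on the order of the arcs that `eq_of_part_eq` requires. -/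
theorem Prec.exists_filter {s t : LabeledConfiguration F} (h : Prec s t) :
    ∃ p : BandedArc F → Bool, t.config.arcs = s.config.arcs.filter p := by
  classical
  induction h with
  | refl => exact ⟨fun _ => true, by simp⟩
  | tail _ hs ih =>
    obtain ⟨p, hp⟩ := ih
    obtain ⟨⟨a, _, hc⟩, _⟩ := hs
    refine ⟨fun b => decide (b ∉ ({a} : Finset (BandedArc F))) && p b, ?_⟩
    rw [hc, ← List.filter_filter, ← hp]
    simp [ResolutionConfiguration.surgery]

/-- The partial order is the product of the partial orders of the parts. -/
theorem prec_iff_part {s t : LabeledConfiguration F} (hs : s.config.IsSplit U)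
    (ht : t.config.IsSplit U) {p : BandedArc F → Bool}
    (hp : t.config.arcs = s.config.arcs.filter p) :
    Prec s t ↔ ∀ i, Prec (s.part hs i) (t.part ht i) := by
  classical
  have := Fintype.ofFinite ι
  refine ⟨fun h i => h.part hs ht i, fun h => ?_⟩
  -- The parts are moved one at a time: after the indices in `T` have been treated, `r` looks like
  -- `t` in those parts and still like `s` in the others.
  have key : ∀ T : Finset ι, ∃ r, ∃ hr : r.config.IsSplit U, Prec s r ∧
      (∀ i ∈ T, r.part hr i = t.part ht i) ∧ ∀ i ∉ T, r.part hr i = s.part hs i := by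
    intro T
    induction T using Finset.induction_on with
    | empty => exact ⟨s, hs, .refl, by simp, fun _ _ => rfl⟩
    | insert i T hi ih =>
      obtain ⟨r, hr, hsr, hT, hnT⟩ := ih
      obtain ⟨r', hr', hrr, hi', hne⟩ := Prec.lift hr (i := i) (by rw [hnT i hi]; exact h i)
      refine ⟨r', hr', hsr.trans hrr, ?_, ?_⟩
      · intro j hj
        by_cases hji : j = i
        · rw [hji, hi']
        · rw [hne j hji, hT j ((Finset.mem_insert.1 hj).resolve_left hji)]
      · intro j hj
        rw [Finset.mem_insert, not_or] at hj
        rw [hne j hj.1, hnT j hj.2]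
  obtain ⟨r, hr, hsr, hT, _⟩ := key Finset.univ
  -- Now `r` has the same parts as `t`, and the arcs of both are filters of those of `s`, so `r =
  -- t`.
  obtain ⟨q, hq⟩ := hsr.exists_filter
  rwa [← eq_of_part_eq hr ht (fun i => hT i (Finset.mem_univ i)) hq hp]

end LabeledConfiguration

/-! ### The splitting by thickened connected components. -/

namespace ResolutionConfiguration

/-- A set together with the bands of the arcs inside it. -/
def thicken (D : ResolutionConfiguration F) (K : Set F) : Set F :=
  K ∪ ⋃ a ∈ {a | a ∈ D.arcs ∧ a.core ⊆ K}, a.strip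

theorem mem_thicken {D : ResolutionConfiguration F} {K : Set F} {x : F} :
    x ∈ D.thicken K ↔ x ∈ K ∨ ∃ a ∈ D.arcs, a.core ⊆ K ∧ x ∈ a.strip := by
  simp [thicken, and_assoc]

theorem exists_component_of_subset {D : ResolutionConfiguration F} {T : Set F}
    (hT : IsPreconnected T) (hne : T.Nonempty) (hTD : T ⊆ D.support) :
    ∃ K : D.components, T ⊆ K.1 := by
  obtain ⟨p, hp⟩ := hne
  exact ⟨⟨_, p, hTD hp, rfl⟩, hT.subset_connectedComponentIn hp hTD⟩

theorem exists_component_circle {D : ResolutionConfiguration F} {C : Set F} (hC : C ∈ D.circles) :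
    ∃ K : D.components, C ⊆ K.1 :=
  exists_component_of_subset (D.isEmbeddedCircle C hC).isConnected.isPreconnected
    (circle_nonempty hC) (D.circle_subset_support hC)

theorem exists_component_core {D : ResolutionConfiguration F} {a : BandedArc F}
    (ha : a ∈ D.arcs) : ∃ K : D.components, a.core ⊆ K.1 :=
  exists_component_of_subset a.isPreconnected_core a.core_nonempty (D.core_subset_support ha)

theorem subset_thicken (D : ResolutionConfiguration F) (K : Set F) : K ⊆ D.thicken K :=
  subset_union_left

variable [T2Space F]

/-- The band of an arc in a component meets the circles and arcs of `D` in that component only. -/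
theorem mem_component_of_mem_strip {D : ResolutionConfiguration F} {K L : Set F}
    (hK : K ∈ D.components) (hL : L ∈ D.components) {a : BandedArc F} (ha : a ∈ D.arcs)
    (haK : a.core ⊆ K) {x : F} (hx : x ∈ a.strip) (hxL : x ∈ L) : K = L := by
  -- The point `x` of `L` lies on a circle or on the core of an arc. On a circle, `x` is in an end
  -- of the band, and the ends lie on circles inside `K` since `K` is saturated. On a core,
  -- disjointness of distinct bands forces that arc to be `a`.
  rcases subset_of_mem_componentsOf' hL hxL with h | h
  · have hxe : x ∈ a.ends := by
      rw [← D.strip_inter a ha]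
      exact ⟨hx, h⟩
    obtain ⟨C, hC, hxC⟩ := (D.isSaturated_of_mem_components hK).ends_subset ha haK hxe
    exact eq_of_mem_componentsOf hK hL (hC.2 hxC) hxL
  · simp only [mem_iUnion, exists_prop] at h
    obtain ⟨b, hb, hxb⟩ := h
    by_cases hab : a = b
    · exact eq_of_mem_componentsOf hK hL (haK (hab ▸ hxb)) hxL
    · exact absurd (b.core_subset_strip hxb) (Set.disjoint_left.1 (D.disjoint_strip ha hb hab) hx)

/-- The thickened components split a configuration. -/
theorem isSplit_thicken (D : ResolutionConfiguration F) :
    D.IsSplit fun K : D.components => D.thicken K.1 where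
  disjoint K L hKL := by
    refine Set.disjoint_left.2 fun x hx hx' => hKL ?_
    refine Subtype.ext ?_
    rcases mem_thicken.1 hx with h | ⟨a, ha, haK, hxa⟩
    · rcases mem_thicken.1 hx' with h' | ⟨b, hb, hbL, hxb⟩
      · exact eq_of_mem_componentsOf K.2 L.2 h h'
      · exact (mem_component_of_mem_strip L.2 K.2 hb hbL hxb h).symm
    · rcases mem_thicken.1 hx' with h' | ⟨b, hb, hbL, hxb⟩
      · exact mem_component_of_mem_strip K.2 L.2 ha haK hxa h'
      · by_cases hab : a = b
        · subst hab
          obtain ⟨y, hy⟩ := a.core_nonempty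
          exact eq_of_mem_componentsOf K.2 L.2 (haK hy) (hbL hy)
        · exact absurd hxb (Set.disjoint_left.1 (D.disjoint_strip ha hb hab) hxa)
  circle C hC := by
    obtain ⟨K, hK⟩ := exists_component_circle hC
    exact ⟨K, hK.trans (D.subset_thicken K.1)⟩
  strip a ha := by
    obtain ⟨K, hK⟩ := exists_component_core ha
    exact ⟨K, fun x hx => mem_thicken.2 (Or.inr ⟨a, ha, hK, hx⟩)⟩

theorem part_thicken (D : ResolutionConfiguration F) (K : D.components) :
    part D.isSplit_thicken K = D.restrict K.1 (D.isSaturated_of_mem_components K.2) := by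
  classical
  apply ext_of_mem
  · ext C
    -- Thickening captures no new circle: each circle lies in some component `L`, and if it also
    -- lies in the thickening of `K`, then `K = L` by disjointness. The same argument applies to
    -- arcs below.
    refine and_congr_right fun hC => ⟨fun h => ?_, fun h => h.trans (D.subset_thicken K.1)⟩
    obtain ⟨L, hL⟩ := exists_component_circle hC
    obtain ⟨x, hx⟩ := circle_nonempty hC
    have := D.isSplit_thicken.eq_of_mem (i := K) (j := L) (h hx) (D.subset_thicken _ (hL hx))
    rwa [this]
  · simp only [part, restrict]
    refine List.filter_congr fun a ha => decide_eq_decide.2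
      ⟨fun h => ?_, fun h => h.trans (D.subset_thicken K.1)⟩
    obtain ⟨L, hL⟩ := exists_component_core ha
    obtain ⟨x, hx⟩ := a.core_nonempty
    have := D.isSplit_thicken.eq_of_mem (i := K) (j := L) (h hx) (D.subset_thicken _ (hL hx))
    rwa [this]

end ResolutionConfiguration

/-! ### Multiplicities: factorization for fixed `A`, and maximizing sets of arcs. -/

namespace DecoratedConfiguration

open ResolutionConfiguration

variable [T2Space F] (𝒟 : DecoratedConfiguration F)

theorem mem_component_arcs {𝒟 : DecoratedConfiguration F} {K : 𝒟.config.components}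
    {a : BandedArc F} :
    a ∈ (𝒟.component K).config.arcs ↔ a ∈ 𝒟.config.arcs ∧ a.core ⊆ K.1 :=
  mem_restrict_arcs (hK := 𝒟.config.isSaturated_of_mem_components K.2)

theorem initial_part (K : 𝒟.config.components) :
    𝒟.initial.part (U := fun K : 𝒟.config.components => 𝒟.config.thicken K.1)
      𝒟.config.isSplit_thicken K = (𝒟.component K).initial :=
  LabeledConfiguration.ext_of_label (𝒟.config.part_thicken K) fun _ _ _ => rfl

theorem part_surgery_thicken (K : 𝒟.config.components) (A : Finset (BandedArc F)) :
    part (𝒟.config.isSplit_thicken.surgery A) K = (𝒟.component K).config.surgery A := by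
  rw [part_surgery 𝒟.config.isSplit_thicken, part_thicken]
  rfl

theorem isSplit_final :
    𝒟.final.config.IsSplit fun K : 𝒟.config.components => 𝒟.config.thicken K.1 :=
  𝒟.config.isSplit_thicken.surgery _

/-- On the left the surgery uses all arcs of `𝒟`, on the right only those of the component. The arcs
of other components have no effect on this part, by `surgery_congr`. -/
theorem final_part (K : 𝒟.config.components) :
    𝒟.final.part 𝒟.isSplit_final K = (𝒟.component K).final := by
  classical
  refine LabeledConfiguration.ext_of_label ?_ fun _ _ _ => rfl
  refine (𝒟.part_surgery_thicken K _).trans (surgery_congr fun a ha => ?_)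
  have ha' := (mem_component_arcs.1 ha).1
  exact iff_of_true (List.mem_toFinset.2 ha') (List.mem_toFinset.2 ha)

/-- The interval between the initial and the final labeled configuration is a product of intervals:
`prec_iff_part` is applied to both of its defining relations. -/
theorem mem_poset_iff (A : Finset (BandedArc F)) (z : (𝒟.config.surgery A).circles → Label) :
    (⟨𝒟.config.surgery A, z⟩ : LabeledConfiguration F) ∈ 𝒟.poset ↔
      ∀ K : 𝒟.config.components,
        (⟨part (𝒟.config.isSplit_thicken.surgery A) K, fun C => z ⟨C.1, C.2.1⟩⟩ :
          LabeledConfiguration F) ∈ (𝒟.component K).poset := by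
  classical
  set s : LabeledConfiguration F := ⟨𝒟.config.surgery A, z⟩
  have hs : s.config.IsSplit fun K : 𝒟.config.components => 𝒟.config.thicken K.1 :=
    𝒟.config.isSplit_thicken.surgery A
  have h1 : LabeledConfiguration.Prec 𝒟.initial s ↔
      ∀ K, LabeledConfiguration.Prec (𝒟.component K).initial (s.part hs K) := by
    rw [LabeledConfiguration.prec_iff_part (s := 𝒟.initial) 𝒟.config.isSplit_thicken hs
      (p := fun a => a ∉ A) (by simp [s, initial, ResolutionConfiguration.surgery])]
    simp only [initial_part]
  have h2 : LabeledConfiguration.Prec s 𝒟.final ↔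
      ∀ K, LabeledConfiguration.Prec (s.part hs K) (𝒟.component K).final := by
    -- The final configuration has no arcs left, so its list of arcs is the filter of any list by
    -- the constant `false`.
    rw [LabeledConfiguration.prec_iff_part hs 𝒟.isSplit_final (p := fun _ => false)
      (by simp [final, maxSurgery, ResolutionConfiguration.surgery])]
    simp only [final_part]
  change _ ∧ _ ↔ ∀ K, _ ∧ _
  rw [h1, h2, ← forall_and]
  rfl

/-- Labelings of `s_A(D)` correspond to families of labelings of its parts, and `mem_poset_iff` says
that admissibility is tested part by part. The same `A` appears in every factor, because a component
ignores the arcs that it does not contain. -/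
theorem multiplicityAt_eq_prod (A : Finset (BandedArc F)) :
    𝒟.multiplicityAt A = ∏ K : 𝒟.config.components, (𝒟.component K).multiplicityAt A := by
  -- Rewriting the surgered component as a part of the surgered configuration puts its labelings on
  -- the circles that `circlesEquiv` handles.
  have hK : ∀ K : 𝒟.config.components, (𝒟.component K).multiplicityAt A =
      Nat.card {z : (part (𝒟.config.isSplit_thicken.surgery A) K).circles → Label //
        (⟨_, z⟩ : LabeledConfiguration F) ∈ (𝒟.component K).poset} := by
    intro K
    rw [multiplicityAt, ← part_surgery_thicken]
  simp only [hK]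
  rw [← Nat.card_pi, multiplicityAt]
  refine Nat.card_congr (Equiv.trans ?_ (Equiv.subtypePiEquivPi (p := fun K z =>
    (⟨part (𝒟.config.isSplit_thicken.surgery A) K, z⟩ : LabeledConfiguration F) ∈
      (𝒟.component K).poset)))
  exact Equiv.subtypeEquiv
    ((Equiv.arrowCongr (circlesEquiv (𝒟.config.isSplit_thicken.surgery A)).symm
      (Equiv.refl Label)).trans (Equiv.piCurry fun _ _ => Label)) fun z => 𝒟.mem_poset_iff A z

theorem multiplicityAt_congr {A B : Finset (BandedArc F)}
    (h : ∀ a ∈ 𝒟.config.arcs, a ∈ A ↔ a ∈ B) : 𝒟.multiplicityAt A = 𝒟.multiplicityAt B := by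
  rw [multiplicityAt, multiplicityAt, surgery_congr h]

/-- Holds for every `A`, even with arcs foreign to `𝒟`, since only the intersection of `A` with the
arcs of `𝒟` matters. The generality is needed because `multiplicityAt_eq_prod` evaluates all
components at one common `A`. -/
theorem multiplicityAt_le (A : Finset (BandedArc F)) : 𝒟.multiplicityAt A ≤ 𝒟.multiplicity := by
  classical
  rw [𝒟.multiplicityAt_congr (B := 𝒟.config.arcs.toFinset ∩ A) fun a ha => by simp [ha]]
  refine Finset.le_sup (f := 𝒟.multiplicityAt) ?_
  rw [Finset.mem_powerset]
  intro a ha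
  simpa using (Finset.mem_inter.1 ha).1

theorem exists_multiplicityAt_eq :
    ∃ A : Finset (BandedArc F), (∀ a ∈ A, a ∈ 𝒟.config.arcs) ∧
      𝒟.multiplicityAt A = 𝒟.multiplicity := by
  classical
  obtain ⟨A, hA, h⟩ := Finset.exists_mem_eq_sup 𝒟.config.arcs.toFinset.powerset
    (Finset.powerset_nonempty _) 𝒟.multiplicityAt
  refine ⟨A, fun a ha => by simpa using Finset.mem_powerset.1 hA ha, ?_⟩
  rw [← h, multiplicity]

end DecoratedConfiguration

end Resolution

theorem mainTheorem12 {F : Type*} [TopologicalSpace F] [T2Space F] [CompactSpace F]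
    [ChartedSpace (EuclideanSpace ℝ (Fin 2)) F] (𝒟 : Resolution.DecoratedConfiguration F) :
    𝒟.multiplicity = ∏ K : 𝒟.config.components, (𝒟.component K).multiplicity := by
  classical
  apply le_antisymm
  -- Upper bound: at a set `A` that is optimal for `𝒟`, each factor is at most the multiplicity of
  -- its component.
  · obtain ⟨A, _, hA⟩ := 𝒟.exists_multiplicityAt_eq
    rw [← hA, 𝒟.multiplicityAt_eq_prod]
    exact Finset.prod_le_prod' fun K _ => (𝒟.component K).multiplicityAt_le A
  -- Lower bound: the union of optimal sets `A K` is optimal for all components at once. An arc of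
  -- component `K` that belongs to `A L` has its nonempty core in both `K` and `L`, hence `K = L`;
  -- so the union contains no further arcs of component `K` than `A K` does.
  · choose A hA hm using fun K => (𝒟.component K).exists_multiplicityAt_eq
    have key : ∀ K, (𝒟.component K).multiplicityAt (Finset.univ.biUnion A) =
        (𝒟.component K).multiplicity := by
      intro K
      rw [← hm K]
      refine (𝒟.component K).multiplicityAt_congr fun a ha => ?_
      simp only [Finset.mem_biUnion, Finset.mem_univ, true_and]
      refine ⟨fun ⟨L, hL⟩ => ?_, fun h => ⟨K, h⟩⟩
      obtain ⟨x, hx⟩ := a.core_nonempty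
      have hLx := (Resolution.DecoratedConfiguration.mem_component_arcs.1 (hA L a hL)).2 hx
      have hKx := (Resolution.DecoratedConfiguration.mem_component_arcs.1 ha).2 hx
      rwa [Subtype.ext (Resolution.eq_of_mem_componentsOf K.2 L.2 hKx hLx)]
    rw [← Finset.prod_congr rfl fun K _ => key K, ← 𝒟.multiplicityAt_eq_prod]
    exact 𝒟.multiplicityAt_le _
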